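/- For $s=\sigma+it\in\mathbb{C}$ let $$\mathfrak f(s)=\int_{0\swarrow 1}\frac{x^{-s}e^{\pi i x^2}}{e^{\pi i x}-e^{-\pi i x}}\,dx,$$ where $x^{-s}$ has its principal value (plane cut along the negative real axis) and the path $0\swarrow1$ is a straight line parallel to the bisector of the first and third quadrants, crossing the real axis between $0$ and $1$ and traversed from upper right to lower left. Let $$g(s)=\pi^{-\frac{s+1}{2}}e^{-\frac{\pi i s}{4}}\,\Gamma\!\left(\tfrac{s+1}{2}\right)\mathfrak f(s).$$ In the region $t>0$, $-\sigma\ge t^{3/7}$ put $\eta=\sqrt{\frac{s-1}{2\pi i}}$ with $0<\arg\eta<\frac{\pi}{4}$. Then, as $|s|\to\infty$ within this region (uniformly, i.e. the ratio of the two sides tends to $1$), $$\mathfrak f(s)\sim e^{\frac{\pi i}{4}\left(s-\frac72\right)}\,\pi^{\frac{s-1}{2}}\,\sin\frac{\pi s}{2}\;\Gamma\!\left(\frac{1-s}{2}\right)\frac{\sin\pi\eta}{\cos2\pi\eta},$$ and, equivalently, $$g(s)\sim e^{-\frac{7\pi i}{8}}\,\tan\frac{\pi s}{2}\;\frac{\sin\pi\eta}{\cos2\pi\eta}.$$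 In particular there is a real number $R$ such that $\mathfrak f(s)\neq0$ for all $s$ in the region with $|s|>R$. -/

import Mathlib

open Filter Asymptotics Bornology

/-- The integrand `x^{-s} e^{π i x²} / (e^{π i x} - e^{-π i x})`, with the principal value of
`x^{-s}` in the plane cut along the negative real axis. -/
noncomputable def auxIntegrand (s x : ℂ) : ℂ :=
  x ^ (-s) * Complex.exp (Real.pi * Complex.I * x ^ 2) /
    (Complex.exp (Real.pi * Complex.I * x) - Complex.exp (-(Real.pi * Complex.I * x)))

/-- Riemann's auxiliary function `𝔣(s)`: the integral of `auxIntegrand s` along the straight line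
parallel to the bisector of the first and third quadrants which crosses the real axis between
`0` and `1` (here at `1/2`; by Cauchy's theorem the choice of the crossing point is immaterial).
The line `x = 1/2 + e^{π i/4} r` is traversed from the upper right to the lower left, that is with
`r` decreasing from `+∞` to `-∞`, whence the factor `-e^{π i/4}`. -/
noncomputable def riemannAux (s : ℂ) : ℂ :=
  -Complex.exp (Real.pi * Complex.I / 4) *
    ∫ r : ℝ, auxIntegrand s (1 / 2 + Complex.exp (Real.pi * Complex.I / 4) * r)

/-- `g(s) = π^{-(s+1)/2} e^{-π i s/4} Γ((s+1)/2) 𝔣(s)`. -/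
noncomputable def riemannAuxG (s : ℂ) : ℂ :=
  (Real.pi : ℂ) ^ (-((s + 1) / 2)) * Complex.exp (-(Real.pi * Complex.I * s / 4)) *
    Complex.Gamma ((s + 1) / 2) * riemannAux s

/-- `η(s) = √((s-1)/(2πi))`, principal square root. -/
noncomputable def etaRoot (s : ℂ) : ℂ :=
  ((s - 1) / (2 * Real.pi * Complex.I)) ^ (1 / 2 : ℂ)

/-- The region `t > 0`, `-σ ≥ t^{3/7}`, where `s = σ + i t`. -/
def farLeftRegion : Set ℂ :=
  {s : ℂ | 0 < s.im ∧ s.im ^ (3 / 7 : ℝ) ≤ -s.re}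

theorem etaRoot_sq (s : ℂ) : etaRoot s ^ 2 = (s - 1) / (2 * Real.pi * Complex.I) := by
  unfold etaRoot
  rw [← Complex.cpow_nat_mul]
  norm_num

/-- In the far left region `etaRoot` is the branch of the square root with `0 < arg η < π/4`. -/
theorem etaRoot_arg (s : ℂ) (hs : s ∈ farLeftRegion) :
    0 < (etaRoot s).arg ∧ (etaRoot s).arg < Real.pi / 4 := by
  obtain ⟨h1, h2⟩ := hs
  have h3 : s.re < 0 := by have := Real.rpow_pos_of_pos h1 (3/7); linarith
  have hp := Real.pi_pos
  set w : ℂ := (s - 1) / (2 * Real.pi * Complex.I) with hw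
  have hw' : w = ((2 * Real.pi)⁻¹ : ℝ) * (⟨s.im, 1 - s.re⟩ : ℂ) := by
    rw [hw, div_eq_iff (by simp [hp.ne'])]
    have hpc : (Real.pi : ℂ) ≠ 0 := by exact_mod_cast hp.ne'
    push_cast
    field_simp
    apply Complex.ext <;> simp
  have hre : 0 < w.re := by rw [hw', Complex.re_ofReal_mul]; positivity
  have him : 0 < w.im := by
    rw [hw', Complex.im_ofReal_mul]; exact mul_pos (by positivity) (by simp; linarith)
  have hw0 : w ≠ 0 := by rintro h; simp [h] at hre
  have ha : 0 < w.arg := by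
    rcases (Complex.arg_nonneg_iff.2 him.le).lt_or_eq with h | h
    · exact h
    · exact absurd (Complex.arg_eq_zero_iff.1 h.symm).2 him.ne'
  have hb : w.arg < Real.pi / 2 :=
    (le_abs_self _).trans_lt (Complex.abs_arg_lt_pi_div_two_iff.2 (Or.inl hre))
  have he : (etaRoot s).arg = w.arg / 2 := by
    change (w ^ (1 / 2 : ℂ)).arg = _
    rw [Complex.cpow_def_of_ne_zero hw0, Complex.arg_exp]
    have : (Complex.log w * (1 / 2)).im = w.arg / 2 := by
      rw [show (1 / 2 : ℂ) = ((1 / 2 : ℝ) : ℂ) by push_cast; rfl, Complex.im_mul_ofReal,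
        Complex.log_im]; ring
    rw [this, toIocMod_eq_self]
    constructor <;> linarith
  rw [he]
  constructor <;> linarith

/-! When `s.re < -1`, the zero of x^{-s} at the origin absorbs the pole of 1/(e^{πix} - e^{-πix}),
so both halves of the line can be slid to start at 0. The two integrals over [0, 1/2] cancel, and
the two opposite rays differ only by the factor -e^{πis}. This leaves 𝔣(s) as an explicit factor
times the integral A of the same integrand over the ray arg x = π/4 (`riemannAux_eq_ray`).

The weight x^{1-s} e^{πix²} (relative to dx/x) has its saddle at η, with steepest descent direction
e^{πi/4}. The saddle point method cannot be applied to A as it stands, because Im η may tend to 0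
and the descent line then runs among the poles on the real axis. Put q = e^{πix} and expand 1/(q -
q⁻¹) = -∑_{k<K} q^{2k+1} + q^{2K}/(q - q⁻¹) (`geometric_expansion`). The moments ∫ x^{-s} e^{πix²}
q^m dx have no poles, so their paths may cross the positive real axis freely. Only the remainder is
confined to the upper half plane, and there q^{2K} makes it exponentially small (`norm_rayTail_le`).

With m extra factors q the saddle moves to about η - m/4. Completing the square gives the m-th
moment as W·2^{-1/2}·e^{πimη - πim²/8}, where W is the weight at η, with relative error O(K^{-3})
for m ≤ 2K as soon as K⁶ is comparable to |η| (`norm_rayMoment_sub_le`). For odd m the phase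
e^{-πim²/8} is e^{-πi/8} times a sign depending on m mod 8, so the main terms form a geometric
series with sum a multiple of sin πη / cos 2πη (`sum_momentFactor`). The moment m = 0 is exactly a
Gamma value (`rayMoment_zero`). Comparing A with it, rather than with W, produces the Gamma factor
without Stirling's formula.

The main term is not too small: |sin πη / cos 2πη| ≥ e^{-πb}/(2 + 1/b) with b = Im η
(`sin_div_cos_lower`). The K moment errors add up to O(K^{-2}) e^{-πb}, which is O(1/K) relative to
the main term once 1/b = O(K). The remainder needs Kb to grow like a power of K. Both follow from
the region: -σ ≥ t^{3/7} forces b ≥ |η|^{-1/7}/16 (`one_le_etaRoot_im_mul`), hence Kb ≥ K^{1/7}/16.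
The statement on g follows by the reflection formula, and nonvanishing holds because the approximant
has no zeros in the region. -/

open MeasureTheory Set Topology

/-! ### Cauchy's theorem on a half strip -/

/-- Cauchy's theorem for a half strip: parallel rays in the direction `ω` issuing from `a` and
from `b` give the same integral up to the integral over the segment joining `a` and `b`. -/
theorem ray_shift {F : ℂ → ℂ} {a b ω : ℂ} {C : ℝ}
    (hc : ∀ v ∈ Icc (0 : ℝ) 1, ∀ r : ℝ, 0 ≤ r → ContinuousAt F (a + v * (b - a) + ω * r))
    (hd : ∀ v ∈ Ioo (0 : ℝ) 1, ∀ r : ℝ, 0 < r → DifferentiableAt ℂ F (a + v * (b - a) + ω * r))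
    (hb : ∀ v ∈ Icc (0 : ℝ) 1, ∀ r : ℝ, 1 ≤ r →
      ‖F (a + v * (b - a) + ω * r)‖ ≤ C * Real.exp (-r)) :
    IntegrableOn (fun r : ℝ => F (a + ω * r)) (Ioi 0) ∧
    IntegrableOn (fun r : ℝ => F (b + ω * r)) (Ioi 0) ∧
    ω * ∫ r in Ioi (0 : ℝ), F (a + ω * r) =
      (b - a) * (∫ v in (0 : ℝ)..1, F (a + v * (b - a))) +
        ω * ∫ r in Ioi (0 : ℝ), F (b + ω * r) := by
  have hint : ∀ v ∈ Icc (0 : ℝ) 1,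
      IntegrableOn (fun r : ℝ => F (a + v * (b - a) + ω * r)) (Ioi 0) := by
    intro v hv
    have hcont : ContinuousOn (fun r : ℝ => F (a + v * (b - a) + ω * r)) (Ici 0) := by
      intro r hr
      apply ContinuousAt.continuousWithinAt
      exact ContinuousAt.comp (f := fun r : ℝ => a + v * (b - a) + ω * r) (hc v hv r hr)
        (by fun_prop)
    rw [← Ioc_union_Ioi_eq_Ioi zero_le_one]
    refine IntegrableOn.union ?_ ?_
    · exact ((hcont.mono Icc_subset_Ici_self).integrableOn_Icc).mono_set Ioc_subset_Icc_self
    · refine Integrable.mono' (g := fun r : ℝ => C * Real.exp (-r)) ?_ ?_ ?_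
      · exact (integrableOn_exp_neg_Ioi 1).const_mul C
      · exact (hcont.mono (Ioi_subset_Ici zero_le_one)).aestronglyMeasurable measurableSet_Ioi
      · refine (ae_restrict_iff' measurableSet_Ioi).2 (ae_of_all _ fun r hr => ?_)
        exact hb v hv r (mem_Ioi.1 hr).le
  have ha := hint 0 (by simp)
  have hb' := hint 1 (by simp)
  simp only [Complex.ofReal_zero, zero_mul, add_zero] at ha
  simp only [Complex.ofReal_one, one_mul, add_sub_cancel] at hb'
  refine ⟨ha, hb', ?_⟩
  -- The parallelogram truncated at height R; its far side tends to 0 by the decay bound.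
  have key : ∀ R : ℝ, 0 ≤ R →
      ω * ∫ r in (0 : ℝ)..R, F (a + ω * r) =
        (b - a) * (∫ v in (0 : ℝ)..1, F (a + v * (b - a))) +
        ω * (∫ r in (0 : ℝ)..R, F (b + ω * r)) -
        (b - a) * (∫ v in (0 : ℝ)..1, F (a + v * (b - a) + ω * R)) := by
    intro R hR
    let Φ : ℝ × ℝ → ℂ := fun p => a + p.1 * (b - a) + ω * p.2
    let Λ : ℝ × ℝ →L[ℝ] ℂ :=
      ((Complex.ofRealCLM.comp (ContinuousLinearMap.fst ℝ ℝ ℝ)).smulRight (b - a) : _) +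
        (Complex.ofRealCLM.comp (ContinuousLinearMap.snd ℝ ℝ ℝ)).smulRight ω
    have hΦ : ∀ p, HasFDerivAt Φ Λ p := by
      intro p
      have : Φ = fun p => a + Λ p := by
        funext p; simp [Φ, Λ]; ring
      rw [this]
      exact Λ.hasFDerivAt.const_add a
    have hΦc : Continuous Φ := by simp only [Φ]; fun_prop
    have hFc : ContinuousOn (fun p => F (Φ p)) (uIcc 0 1 ×ˢ uIcc 0 R) := by
      rintro p ⟨hp1, hp2⟩
      rw [uIcc_of_le zero_le_one] at hp1
      rw [uIcc_of_le hR] at hp2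
      exact (ContinuousAt.comp (f := Φ) (hc p.1 hp1 p.2 hp2.1) hΦc.continuousAt).continuousWithinAt
    have hFd : ∀ p ∈ Ioo (0 : ℝ) 1 ×ˢ Ioo (0 : ℝ) R,
        HasFDerivAt (fun p => F (Φ p)) ((deriv F (Φ p)) • Λ) p := by
      rintro p ⟨hp1, hp2⟩
      have h1 := ((hd p.1 hp1 p.2 hp2.1).hasDerivAt).complexToReal_fderiv
      have h2 := HasFDerivAt.comp p h1 (hΦ p)
      refine h2.congr_fderiv ?_
      ext <;> simp [Φ]
    -- In the coordinates of `Φ`, the field (ωF, -(b - a)F) is divergence free: the partial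
    -- derivatives of F∘Φ are F'·(b - a) and F'·ω.
    have := integral2_divergence_prod_of_hasFDerivAt_off_countable
      (fun p => ω * F (Φ p)) (fun p => -(b - a) * F (Φ p))
      (fun p => ω • (deriv F (Φ p) • Λ)) (fun p => (-(b - a)) • (deriv F (Φ p) • Λ))
      0 0 1 R ∅ countable_empty (continuousOn_const.mul hFc) (continuousOn_const.mul hFc)
      (by
        intro p hp
        simp only [zero_le_one, inf_of_le_left, sup_of_le_right, hR, sdiff_empty] at hp
        exact (hFd p hp).const_mul ω)
      (by
        intro p hp
        simp only [zero_le_one, inf_of_le_left, sup_of_le_right, hR, sdiff_empty] at hp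
        exact (hFd p hp).const_mul _)
      (by
        refine (integrableOn_zero).congr_fun (fun p _ => ?_) (by measurability)
        simp [Λ]; ring)
    have hz : ∀ x y : ℝ, (ω • (deriv F (Φ (x, y)) • Λ)) (1, 0) +
        ((-(b - a)) • (deriv F (Φ (x, y)) • Λ)) (0, 1) = 0 := by
      intro x y; simp [Λ]; ring
    simp only [hz, intervalIntegral.integral_zero] at this
    simp only [intervalIntegral.integral_const_mul] at this
    simp only [Φ, Complex.ofReal_zero, Complex.ofReal_one, zero_mul, mul_zero, add_zero,
      one_mul, add_sub_cancel] at this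
    linear_combination this
  have hlim : Tendsto (fun R : ℝ => (b - a) * (∫ v in (0 : ℝ)..1, F (a + v * (b - a) + ω * R)))
      atTop (𝓝 0) := by
    have h0 : Tendsto (fun R : ℝ => ∫ v in (0 : ℝ)..1, F (a + v * (b - a) + ω * R))
        atTop (𝓝 0) := by
      refine squeeze_zero_norm' (a := fun R : ℝ => C * Real.exp (-R)) ?_ ?_
      · filter_upwards [eventually_ge_atTop 1] with R hR
        have := intervalIntegral.norm_integral_le_of_norm_le_const
          (a := (0 : ℝ)) (b := 1) (C := C * Real.exp (-R))
          (f := fun v : ℝ => F (a + v * (b - a) + ω * R)) (by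
            intro v hv
            rw [uIoc_of_le zero_le_one] at hv
            exact hb v ⟨hv.1.le, hv.2⟩ R hR)
        simpa using this
      · simpa using (Real.tendsto_exp_neg_atTop_nhds_zero).const_mul C
    simpa using h0.const_mul (b - a)
  have l1 := (intervalIntegral_tendsto_integral_Ioi 0 ha tendsto_id).const_mul ω
  have l2 := ((intervalIntegral_tendsto_integral_Ioi 0 hb' tendsto_id).const_mul ω).const_add
    ((b - a) * (∫ v in (0 : ℝ)..1, F (a + v * (b - a))))
  have l3 := l2.sub hlim
  rw [sub_zero] at l3
  refine tendsto_nhds_unique (l1.congr' ?_) l3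
  filter_upwards [eventually_ge_atTop 0] with R hR
  simpa using key R hR

/-! ### Weight and denominator: zeros, regularity and decay -/

/-- The factor `x^{-s} e^{π i x²}` of the integrand. -/
noncomputable def saddleWeight (s x : ℂ) : ℂ :=
  x ^ (-s) * Complex.exp (Real.pi * Complex.I * x ^ 2)

/-- The denominator `e^{π i x} - e^{-π i x}` of the integrand. -/
noncomputable def sinDenom (x : ℂ) : ℂ :=
  Complex.exp (Real.pi * Complex.I * x) - Complex.exp (-(Real.pi * Complex.I * x))

/-- The direction `e^{π i / 4}` of the rays of integration. -/
noncomputable def diagDir : ℂ := Complex.exp (Real.pi * Complex.I / 4)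

theorem diagDir_sq : diagDir ^ 2 = Complex.I := by
  rw [diagDir, ← Complex.exp_nat_mul]
  convert Complex.exp_pi_div_two_mul_I using 2
  push_cast; ring

theorem diagDir_re : diagDir.re = √2 / 2 := by
  rw [diagDir, show (Real.pi * Complex.I / 4 : ℂ) = ((Real.pi / 4 : ℝ) : ℂ) * Complex.I by
    push_cast; ring, Complex.exp_ofReal_mul_I_re, Real.cos_pi_div_four]

theorem diagDir_im : diagDir.im = √2 / 2 := by
  rw [diagDir, show (Real.pi * Complex.I / 4 : ℂ) = ((Real.pi / 4 : ℝ) : ℂ) * Complex.I by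
    push_cast; ring, Complex.exp_ofReal_mul_I_im, Real.sin_pi_div_four]

theorem norm_diagDir : ‖diagDir‖ = 1 := by
  rw [diagDir, show (Real.pi * Complex.I / 4 : ℂ) = ((Real.pi / 4 : ℝ) : ℂ) * Complex.I by
    push_cast; ring, Complex.norm_exp_ofReal_mul_I]

theorem diagDir_ne_zero : diagDir ≠ 0 := Complex.exp_ne_zero _

theorem auxIntegrand_eq (s x : ℂ) : auxIntegrand s x = saddleWeight s x / sinDenom x := rfl

/-- The two exponentials have moduli e^{∓π Im x}, so their difference is at least 2 sinh(π|Im x|),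
and sinh y ≥ y. -/
theorem two_pi_abs_im_le_norm_sinDenom (x : ℂ) : 2 * Real.pi * |x.im| ≤ ‖sinDenom x‖ := by
  have h1 : ‖Complex.exp (Real.pi * Complex.I * x)‖ = Real.exp (-(Real.pi * x.im)) := by
    rw [Complex.norm_exp]; simp
  have h2 : ‖Complex.exp (-(Real.pi * Complex.I * x))‖ = Real.exp (Real.pi * x.im) := by
    rw [Complex.norm_exp]; simp
  have h3 := abs_norm_sub_norm_le (Complex.exp (Real.pi * Complex.I * x))
    (Complex.exp (-(Real.pi * Complex.I * x)))
  rw [h1, h2] at h3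
  refine le_trans ?_ h3
  have h4 : ∀ y : ℝ, 0 ≤ y → 2 * y ≤ Real.exp y - Real.exp (-y) := by
    intro y hy
    have := Real.self_le_sinh_iff.2 hy
    rw [Real.sinh_eq] at this
    linarith
  have hp := Real.pi_pos
  rcases le_total 0 x.im with h | h
  · have := h4 (Real.pi * x.im) (by positivity)
    rw [abs_of_nonneg h, abs_sub_comm]
    exact le_trans (by linarith) (le_abs_self _)
  · have := h4 (Real.pi * -x.im) (mul_nonneg hp.le (by linarith))
    rw [abs_of_nonpos h]
    refine le_trans ?_ (le_abs_self _)
    rw [mul_neg, neg_neg] at this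
    linarith

theorem sinDenom_eq_sin (x : ℂ) : sinDenom x = 2 * Complex.I * Complex.sin (Real.pi * x) := by
  rw [sinDenom, Complex.sin, show Real.pi * Complex.I * x = Real.pi * x * Complex.I by ring,
    neg_mul]
  linear_combination (-(Complex.exp (-(Real.pi * x * Complex.I)) -
    Complex.exp (Real.pi * x * Complex.I))) * Complex.I_sq

theorem sinDenom_ne_zero {x : ℂ} (hx : x.im ≠ 0 ∨ (0 < x.re ∧ x.re < 1)) : sinDenom x ≠ 0 := by
  rcases hx with hx | ⟨h0, h1⟩
  · have := two_pi_abs_im_le_norm_sinDenom x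
    have h2 : 0 < |x.im| := abs_pos.2 hx
    intro h
    rw [h, norm_zero] at this
    have : 0 < 2 * Real.pi * |x.im| := by positivity
    linarith
  · rw [sinDenom_eq_sin]
    refine mul_ne_zero (by simp) fun h => ?_
    obtain ⟨k, hk⟩ := Complex.sin_eq_zero_iff.1 h
    have hp : (Real.pi : ℂ) ≠ 0 := by exact_mod_cast Real.pi_ne_zero
    have hxk : x = k := mul_left_cancel₀ hp (by rw [hk]; ring)
    rw [hxk, Complex.intCast_re] at h0 h1
    have h0' : 0 < k := by exact_mod_cast h0
    have h1' : k < 1 := by exact_mod_cast h1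
    omega

theorem differentiable_sinDenom : Differentiable ℂ sinDenom := by
  unfold sinDenom; fun_prop

theorem deriv_sinDenom_zero : deriv sinDenom 0 ≠ 0 := by
  have : HasDerivAt sinDenom (Complex.exp (Real.pi * Complex.I * 0) * (Real.pi * Complex.I * 1) -
      Complex.exp (-(Real.pi * Complex.I * 0)) * (-(Real.pi * Complex.I * 1))) 0 := by
    have h := (hasDerivAt_id (0 : ℂ)).const_mul (Real.pi * Complex.I : ℂ)
    exact h.cexp.sub h.neg.cexp
  rw [this.deriv]
  have hp : (Real.pi : ℂ) ≠ 0 := by exact_mod_cast Real.pi_ne_zero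
  simp only [mul_zero, Complex.exp_zero, neg_zero, one_mul, mul_one, sub_neg_eq_add]
  rw [← two_mul]
  simp [hp]

theorem continuousAt_saddleWeight {s x : ℂ} (hs : s.re < 0) (hx : 0 ≤ x.re ∨ x.im ≠ 0) :
    ContinuousAt (saddleWeight s) x :=
  (Complex.continuousAt_cpow_const_of_re_pos hx (by simpa using hs)).mul (by fun_prop)

theorem differentiableAt_saddleWeight {s x : ℂ} (hx : 0 < x.re ∨ x.im ≠ 0) :
    DifferentiableAt ℂ (saddleWeight s) x :=
  (DifferentiableAt.cpow_const (f := fun x => x) differentiableAt_id hx).mul (by fun_prop)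

/-- One factor x is moved from the weight to the denominator, where it removes the simple zero at 0.
The quotient is thereby continuous at the origin. At x = 0 the left side is 0 by the convention for
division by zero, and the right side is 0 because -(s+1) ≠ 0. -/
theorem saddleWeight_div_sinDenom {s : ℂ} (hs : s.re < -1) (x : ℂ) :
    saddleWeight s x / sinDenom x = saddleWeight (s + 1) x / dslope sinDenom 0 x := by
  have h0 : sinDenom 0 = 0 := by simp [sinDenom]
  rcases eq_or_ne x 0 with rfl | hx
  · have : -(s + 1) ≠ 0 := by
      intro h
      have := congrArg Complex.re h
      simp at this
      linarith
    rw [h0]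
    simp only [saddleWeight]
    rw [Complex.zero_cpow this]
    simp
  · rw [dslope_of_ne _ hx, slope_def_field, h0, sub_zero, sub_zero]
    have : x ^ (-s) = x ^ (-(s + 1)) * x := by
      rw [show -s = -(s + 1) + 1 by ring, Complex.cpow_add _ _ hx, Complex.cpow_one]
    simp only [saddleWeight]
    rw [this, div_div_eq_mul_div]
    ring

theorem continuousAt_saddleWeight_div {s x : ℂ} (hs : s.re < -1)
    (hx : x.im ≠ 0 ∨ (0 ≤ x.re ∧ x.re < 1)) :
    ContinuousAt (fun x => saddleWeight s x / sinDenom x) x := by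
  have hfun := funext (saddleWeight_div_sinDenom hs)
  rw [hfun]
  have hx' : 0 ≤ x.re ∨ x.im ≠ 0 := by tauto
  refine (continuousAt_saddleWeight (by simp; linarith) hx').div ?_ ?_
  · rcases eq_or_ne x 0 with rfl | h
    · exact continuousAt_dslope_same.2 differentiable_sinDenom.differentiableAt
    · exact (continuousAt_dslope_of_ne h).2 differentiable_sinDenom.continuous.continuousAt
  · rcases eq_or_ne x 0 with rfl | h
    · rw [dslope_same]; exact deriv_sinDenom_zero
    · rw [dslope_of_ne _ h, slope_def_field]
      have h0 : sinDenom 0 = 0 := by simp [sinDenom]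
      rw [h0, sub_zero, sub_zero]
      refine div_ne_zero (sinDenom_ne_zero ?_) h
      rcases hx with hx | ⟨h1, h2⟩
      · exact Or.inl hx
      · by_cases him : x.im = 0
        · refine Or.inr ⟨lt_of_le_of_ne h1 fun h' => h (Complex.ext ?_ ?_), h2⟩
          · simp [← h']
          · simp [him]
        · exact Or.inl him

theorem differentiableAt_saddleWeight_div {s x : ℂ}
    (hx : x.im ≠ 0 ∨ (0 < x.re ∧ x.re < 1)) :
    DifferentiableAt ℂ (fun x => saddleWeight s x / sinDenom x) x :=
  (differentiableAt_saddleWeight (by tauto)).div differentiable_sinDenom.differentiableAt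
    (sinDenom_ne_zero hx)

/-- Uniform decay of `x^{-s} e^{π i x²}` along rays in the directions `± e^{π i / 4}`. -/
theorem exists_saddleWeight_decay {s ω : ℂ} (hs : s.re ≤ 0) (hω : ω ^ 2 = Complex.I) (M : ℝ) :
    ∃ C : ℝ, 0 ≤ C ∧ ∀ p : ℂ, ‖p‖ ≤ M → ∀ r : ℝ, 0 ≤ r →
      ‖saddleWeight s (p + ω * r)‖ ≤ C * Real.exp (-r) := by
  have hωn : ‖ω‖ = 1 := by
    have : ‖ω‖ ^ 2 = 1 := by rw [← norm_pow, hω, Complex.norm_I]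
    exact (pow_eq_one_iff_of_nonneg (norm_nonneg _) two_ne_zero).1 this
  set n := ⌈-s.re⌉₊ with hn
  have hp := Real.pi_pos
  have hp3 := Real.pi_gt_three
  refine ⟨n.factorial * Real.exp (Real.pi * |s.im|) *
    Real.exp (1 + M + Real.pi * M ^ 2 + (2 * Real.pi * M + 2) ^ 2), by positivity, ?_⟩
  intro p hpM r hr
  have hM : 0 ≤ M := (norm_nonneg p).trans hpM
  set x := p + ω * r with hx
  have hxn : ‖x‖ ≤ M + r := by
    refine (norm_add_le _ _).trans ?_
    rw [norm_mul, hωn, Complex.norm_real, Real.norm_of_nonneg hr, one_mul]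
    linarith
  have h1 : ‖x ^ (-s)‖ ≤ n.factorial * Real.exp (1 + M + r) * Real.exp (Real.pi * |s.im|) := by
    refine (Complex.norm_cpow_le _ _).trans ?_
    rw [div_eq_mul_inv, ← Real.exp_neg]
    gcongr
    · have e1 : ‖x‖ ^ (-s).re ≤ (1 + ‖x‖) ^ (n : ℝ) := by
        calc ‖x‖ ^ (-s).re ≤ (1 + ‖x‖) ^ (-s).re := by
              apply Real.rpow_le_rpow (norm_nonneg _) (by linarith) (by simpa using hs)
          _ ≤ (1 + ‖x‖) ^ (n : ℝ) := by
              apply Real.rpow_le_rpow_of_exponent_le (by linarith [norm_nonneg x])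
              rw [Complex.neg_re]; exact Nat.le_ceil _
      rw [Real.rpow_natCast] at e1
      have e2 := Real.pow_div_factorial_le_exp (1 + ‖x‖) (by positivity) n
      rw [div_le_iff₀ (by positivity)] at e2
      refine e1.trans (e2.trans ?_)
      rw [mul_comm]
      exact mul_le_mul_of_nonneg_left (Real.exp_le_exp.2 (by linarith)) (by positivity)
    · rw [Complex.neg_im, mul_neg, neg_neg]
      calc x.arg * s.im ≤ |x.arg * s.im| := le_abs_self _
        _ = |x.arg| * |s.im| := abs_mul _ _
        _ ≤ _ := by gcongr; exact Complex.abs_arg_le_pi x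
  have h2 : ‖Complex.exp (Real.pi * Complex.I * x ^ 2)‖ ≤
      Real.exp (-(Real.pi * r ^ 2) + 2 * Real.pi * M * r + Real.pi * M ^ 2) := by
    rw [Complex.norm_exp, Real.exp_le_exp]
    -- Because ω² = i, the quadratic term is the real number -πr²; everything else is at most linear
    -- in r.
    have : (Real.pi * Complex.I * x ^ 2 : ℂ) = ((-(Real.pi * r ^ 2) : ℝ) : ℂ) +
        (2 * Real.pi * Complex.I * p * ω * r + Real.pi * Complex.I * p ^ 2) := by
      rw [hx]; push_cast
      linear_combination (Real.pi * Complex.I * r ^ 2) * hω + Real.pi * r ^ 2 * Complex.I_sq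
    rw [this, Complex.add_re, Complex.ofReal_re]
    have h3 : (2 * Real.pi * Complex.I * p * ω * r + Real.pi * Complex.I * p ^ 2 : ℂ).re ≤
        2 * Real.pi * M * r + Real.pi * M ^ 2 := by
      refine (Complex.re_le_norm _).trans ((norm_add_le _ _).trans ?_)
      simp only [norm_mul, hωn, Complex.norm_I, Complex.norm_real, norm_pow, mul_one,
        Real.norm_of_nonneg hr, Real.norm_of_nonneg hp.le]
      norm_num
      gcongr
    linarith
  calc ‖saddleWeight s x‖ ≤ (n.factorial * Real.exp (1 + M + r) * Real.exp (Real.pi * |s.im|)) *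
      Real.exp (-(Real.pi * r ^ 2) + 2 * Real.pi * M * r + Real.pi * M ^ 2) := by
        rw [saddleWeight, norm_mul]; gcongr
    _ = n.factorial * Real.exp (Real.pi * |s.im|) * Real.exp ((1 + M + r) +
      (-(Real.pi * r ^ 2) + 2 * Real.pi * M * r + Real.pi * M ^ 2)) := by
        rw [Real.exp_add (1 + M + r)]; ring
    _ ≤ n.factorial * Real.exp (Real.pi * |s.im|) * Real.exp
      ((1 + M + Real.pi * M ^ 2 + (2 * Real.pi * M + 2) ^ 2) + -r) := by
        refine mul_le_mul_of_nonneg_left (Real.exp_le_exp.2 ?_) (by positivity)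
        -- Completing the square: the Gaussian absorbs the linear terms and leaves a spare e^{-r}.
        nlinarith [sq_nonneg (r / 2 - (2 * Real.pi * M + 2)), sq_nonneg r]
    _ = _ := by rw [Real.exp_add _ (-r)]; ring

/-! ### Reduction to one ray from the origin -/

theorem log_diagDir_mul {r : ℝ} (hr : 0 < r) :
    Complex.log (diagDir * r) = Real.log r + Real.pi * Complex.I / 4 := by
  have hp := Real.pi_pos
  rw [mul_comm, Complex.log_ofReal_mul hr diagDir_ne_zero, diagDir, Complex.log_exp] <;>
    simp <;> linarith

theorem log_neg_diagDir_mul {r : ℝ} (hr : 0 < r) :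
    Complex.log (-diagDir * r) = Real.log r - 3 * Real.pi * Complex.I / 4 := by
  have hp := Real.pi_pos
  have h : -diagDir = Complex.exp (-(3 * Real.pi * Complex.I / 4)) := by
    rw [diagDir, show (Real.pi * Complex.I / 4 : ℂ) =
      -(3 * Real.pi * Complex.I / 4) + Real.pi * Complex.I by ring, Complex.exp_add,
      Complex.exp_pi_mul_I]
    ring
  rw [mul_comm, Complex.log_ofReal_mul hr (neg_ne_zero.2 diagDir_ne_zero), h, Complex.log_exp,
    sub_eq_add_neg]
  · simp; linarith
  · simp; linarith

theorem saddleWeight_diagDir_mul (s : ℂ) {r : ℝ} (hr : 0 < r) :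
    saddleWeight s (diagDir * r) =
      Complex.exp (-(Real.pi * Complex.I * s / 4)) *
        ((r : ℂ) ^ (-s) * Complex.exp (-(Real.pi * r ^ 2))) := by
  have hr' : (r : ℂ) ≠ 0 := by exact_mod_cast hr.ne'
  rw [saddleWeight, Complex.cpow_def_of_ne_zero (mul_ne_zero diagDir_ne_zero hr'),
    log_diagDir_mul hr, Complex.cpow_def_of_ne_zero hr', Complex.ofReal_log hr.le,
    ← Complex.exp_add, ← Complex.exp_add, ← Complex.exp_add, mul_pow, diagDir_sq]
  congr 1
  linear_combination (Real.pi * r ^ 2 : ℂ) * Complex.I_sq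

/-- The principal arguments on the opposite rays are π/4 and -3π/4, which differ by π across the
right half plane, while x² is unchanged. -/
theorem saddleWeight_neg_diagDir_mul (s : ℂ) {r : ℝ} (hr : 0 < r) :
    saddleWeight s (-diagDir * r) =
      Complex.exp (Real.pi * Complex.I * s) * saddleWeight s (diagDir * r) := by
  have hr' : (r : ℂ) ≠ 0 := by exact_mod_cast hr.ne'
  rw [saddleWeight, saddleWeight,
    Complex.cpow_def_of_ne_zero (mul_ne_zero diagDir_ne_zero hr'),
    Complex.cpow_def_of_ne_zero (mul_ne_zero (neg_ne_zero.2 diagDir_ne_zero) hr'),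
    log_diagDir_mul hr, log_neg_diagDir_mul hr, ← Complex.exp_add, ← Complex.exp_add,
    ← Complex.exp_add]
  congr 1
  ring

theorem sinDenom_neg (x : ℂ) : sinDenom (-x) = -sinDenom x := by
  simp [sinDenom]

theorem half_strip_im (ε r v : ℝ) (c : ℂ) (hc : c = ε * diagDir) :
    ((0 : ℂ) + v * (1 / 2 - 0) + c * r).im = ε * r * (√2 / 2) := by
  subst hc
  simp [diagDir_im]; ring

/-- Moving one half of the line of integration to the origin. -/
theorem auxIntegrand_ray_shift {s : ℂ} (hs : s.re < -1) {ε : ℝ} (hε : ε = 1 ∨ ε = -1)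
    {c : ℂ} (hc : c = ε * diagDir) :
    IntegrableOn (fun r : ℝ => auxIntegrand s (0 + c * r)) (Ioi 0) ∧
    IntegrableOn (fun r : ℝ => auxIntegrand s (1 / 2 + c * r)) (Ioi 0) ∧
    c * ∫ r in Ioi (0 : ℝ), auxIntegrand s (0 + c * r) =
      (1 / 2 - 0) * (∫ v in (0 : ℝ)..1, auxIntegrand s (0 + v * (1 / 2 - 0))) +
        c * ∫ r in Ioi (0 : ℝ), auxIntegrand s (1 / 2 + c * r) := by
  have hε2 : ε ^ 2 = 1 := by rcases hε with h | h <;> rw [h] <;> norm_num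
  have hεa : |ε| = 1 := by rcases hε with h | h <;> rw [h] <;> norm_num
  have hε0 : ε ≠ 0 := by rintro rfl; norm_num at hε2
  have hc2 : c ^ 2 = Complex.I := by
    rw [hc, mul_pow, diagDir_sq, ← Complex.ofReal_pow, hε2]; simp
  obtain ⟨C, hC0, hC⟩ := exists_saddleWeight_decay (s := s) (by linarith) hc2 1
  have him := half_strip_im ε
  have h2 : (0 : ℝ) < √2 / 2 := by positivity
  have hreal : ∀ v : ℝ, ((0 : ℂ) + v * (1 / 2 - 0) + c * (0 : ℝ)).re = v / 2 := by
    intro v; simp; ring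
  refine ray_shift (C := C) ?_ ?_ ?_
  · intro v hv r hr
    refine continuousAt_saddleWeight_div hs ?_
    rcases hr.eq_or_lt with rfl | hr
    · right
      rw [hreal]
      constructor <;> linarith [hv.1, hv.2]
    · left
      rw [him r v c hc]
      positivity
  · intro v hv r hr
    refine differentiableAt_saddleWeight_div (Or.inl ?_)
    rw [him r v c hc]
    positivity
  · intro v hv r hr
    have hD : 1 ≤ ‖sinDenom ((0 : ℂ) + v * (1 / 2 - 0) + c * r)‖ := by
      refine le_trans ?_ (two_pi_abs_im_le_norm_sinDenom _)
      rw [him r v c hc, abs_mul, abs_mul, hεa, one_mul, abs_of_pos (by linarith : 0 < r),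
        abs_of_pos h2]
      have h1 : (1 : ℝ) ≤ √2 := by rw [Real.one_le_sqrt]; norm_num
      have hp := Real.pi_gt_three
      have h4 : (1 / 2 : ℝ) ≤ r * (√2 / 2) := by nlinarith
      nlinarith
    rw [auxIntegrand_eq, norm_div]
    refine (div_le_self (norm_nonneg _) hD).trans (hC _ ?_ r (by linarith))
    rw [zero_add, sub_zero, norm_mul, Complex.norm_real, Real.norm_of_nonneg hv.1]
    norm_num
    linarith [hv.2]

/-- Riemann's auxiliary function far to the left, as an integral over the ray `arg x = π / 4`. -/
theorem riemannAux_eq_ray {s : ℂ} (hs : s.re < -1) :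
    riemannAux s = 2 * Complex.I * diagDir * Complex.sin (Real.pi * s / 2) *
      Complex.exp (Real.pi * Complex.I * s / 2) *
      ∫ r in Ioi (0 : ℝ), saddleWeight s (diagDir * r) / sinDenom (diagDir * r) := by
  obtain ⟨-, i1, e1⟩ := auxIntegrand_ray_shift hs (ε := 1) (Or.inl rfl) (c := diagDir) (by simp)
  obtain ⟨-, i2, e2⟩ := auxIntegrand_ray_shift hs (ε := -1) (Or.inr rfl) (c := -diagDir) (by simp)
  have hneg : ∫ r in Ioi (0 : ℝ), auxIntegrand s (0 + -diagDir * r) =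
      -(Complex.exp (Real.pi * Complex.I * s) *
        ∫ r in Ioi (0 : ℝ), auxIntegrand s (0 + diagDir * r)) := by
    rw [← integral_const_mul, ← integral_neg]
    refine setIntegral_congr_fun measurableSet_Ioi fun r hr => ?_
    simp only [zero_add, auxIntegrand_eq]
    rw [saddleWeight_neg_diagDir_mul s hr, neg_mul diagDir, sinDenom_neg, div_neg, mul_div_assoc]
  have hiic : ∫ r in Iic (0 : ℝ), auxIntegrand s (1 / 2 + diagDir * r) =
      ∫ r in Ioi (0 : ℝ), auxIntegrand s (1 / 2 + -diagDir * r) := by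
    have := integral_comp_neg_Ioi (0 : ℝ) fun r : ℝ => auxIntegrand s (1 / 2 + diagDir * r)
    rw [neg_zero] at this
    rw [← this]
    refine setIntegral_congr_fun measurableSet_Ioi fun r _ => ?_
    simp
  have i2' : IntegrableOn (fun r : ℝ => auxIntegrand s (1 / 2 + diagDir * r)) (Iic 0) := by
    have hmp := Measure.measurePreserving_neg (volume : Measure ℝ)
    rw [← hmp.integrableOn_comp_preimage (Homeomorph.neg ℝ).measurableEmbedding]
    have : (Neg.neg ⁻¹' Iic (0 : ℝ)) = Ici 0 := by ext; simp
    rw [this, integrableOn_Ici_iff_integrableOn_Ioi]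
    refine i2.congr_fun (fun r _ => ?_) measurableSet_Ioi
    simp
  have hsplit := intervalIntegral.integral_Iic_add_Ioi i2' i1
  have hA : ∫ r in Ioi (0 : ℝ), saddleWeight s (diagDir * r) / sinDenom (diagDir * r) =
      ∫ r in Ioi (0 : ℝ), auxIntegrand s (0 + diagDir * r) := by
    simp only [zero_add, auxIntegrand_eq]
  rw [hA]
  rw [hneg] at e2
  have hdef : riemannAux s = -diagDir * ∫ r : ℝ, auxIntegrand s (1 / 2 + diagDir * r) := rfl
  rw [hdef, ← hsplit, hiic]
  set A := ∫ r in Ioi (0 : ℝ), auxIntegrand s (0 + diagDir * r)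
  have hsin : 2 * Complex.I * Complex.sin (Real.pi * s / 2) *
      Complex.exp (Real.pi * Complex.I * s / 2) = Complex.exp (Real.pi * Complex.I * s) - 1 := by
    have h1 : Complex.exp (Real.pi * Complex.I * s) =
        Complex.exp (Real.pi * Complex.I * s / 2) * Complex.exp (Real.pi * Complex.I * s / 2) := by
      rw [← Complex.exp_add]; ring_nf
    have h2 : Complex.exp (-(Real.pi * Complex.I * s / 2)) *
        Complex.exp (Real.pi * Complex.I * s / 2) = 1 := by
      rw [← Complex.exp_add]; simp
    rw [Complex.sin, show Real.pi * s / 2 * Complex.I = Real.pi * Complex.I * s / 2 by ring,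
      show -(Real.pi * s / 2) * Complex.I = -(Real.pi * Complex.I * s / 2) by ring, h1]
    linear_combination (norm := ring_nf) (-1 : ℂ) * h2
    rw [Complex.I_sq]
    ring
  -- In `e1 - e2` the integrals over the segment [0, 1/2] cancel.
  linear_combination (-diagDir * A) * hsin + e1 - e2

/-! ### Moments and the geometric expansion of the denominator -/

/-- The moments `∫ x^{-s} e^{π i x² + π i m x} dx` over the ray `arg x = π / 4`. -/
noncomputable def rayMoment (s : ℂ) (m : ℕ) : ℂ :=
  ∫ r in Ioi (0 : ℝ),
    saddleWeight s (diagDir * r) * Complex.exp (Real.pi * Complex.I * m * (diagDir * r))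

/-- On the ray the weight is a constant times r^{-s} e^{-πr²}; substituting t = r² turns the
integral into Euler's. -/
theorem rayMoment_zero {s : ℂ} (hs : s.re < 1) :
    rayMoment s 0 = Complex.exp (-(Real.pi * Complex.I * s / 4)) *
      (1 / 2 * ((Real.pi : ℂ) ^ ((s - 1) / 2) * Complex.Gamma ((1 - s) / 2))) := by
  have hG := Complex.integral_cpow_mul_exp_neg_mul_Ioi (a := (1 - s) / 2) (r := Real.pi)
    (by rw [show (1 - s) / 2 = ((1 / 2 : ℝ) : ℂ) * (1 - s) by push_cast; ring,
          Complex.re_ofReal_mul]; simp; linarith) Real.pi_pos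
  have hsub := integral_comp_rpow_Ioi_of_pos
    (g := fun t : ℝ => (t : ℂ) ^ ((1 - s) / 2 - 1) * Complex.exp (-(Real.pi * t))) two_pos
  rw [hG] at hsub
  have hpi : (1 / (Real.pi : ℂ)) ^ ((1 - s) / 2) = (Real.pi : ℂ) ^ ((s - 1) / 2) := by
    rw [one_div, Complex.inv_cpow _ _ (by
      rw [Complex.arg_ofReal_of_nonneg Real.pi_pos.le]; exact Real.pi_pos.ne), ← Complex.cpow_neg]
    congr 1; ring
  rw [← hpi, ← hsub, rayMoment, ← integral_const_mul, ← integral_const_mul]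
  refine setIntegral_congr_fun measurableSet_Ioi fun r hr => ?_
  have hr0 : (0 : ℝ) < r := hr
  have hr' : (r : ℂ) ≠ 0 := by exact_mod_cast hr0.ne'
  have h1 : ((r ^ 2 : ℝ) : ℂ) ^ ((1 - s) / 2 - 1) = (r : ℂ) ^ (-s) * (r : ℂ)⁻¹ := by
    rw [Complex.ofReal_pow, ← Complex.cpow_neg_one, ← Complex.cpow_add _ _ hr',
      Complex.cpow_def_of_ne_zero (pow_ne_zero _ hr'), Complex.cpow_def_of_ne_zero hr',
      ← Complex.ofReal_pow, ← Complex.ofReal_log (by positivity), ← Complex.ofReal_log hr0.le,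
      Real.log_pow]
    congr 1
    push_cast
    ring
  have h2 : (2 : ℝ) - 1 = 1 := by norm_num
  simp only [saddleWeight_diagDir_mul s hr0, h2, Real.rpow_one, Real.rpow_two]
  rw [h1]
  simp only [Complex.real_smul]
  push_cast
  simp only [mul_zero, zero_mul, Complex.exp_zero, mul_one]
  field_simp

theorem strip_re (v r : ℝ) (x₁ : ℂ) :
    ((0 : ℂ) + v * (x₁ - 0) + diagDir * r).re = v * x₁.re + r * (√2 / 2) := by
  simp [diagDir_re]; ring

theorem strip_im (v r : ℝ) (x₁ : ℂ) :
    ((0 : ℂ) + v * (x₁ - 0) + diagDir * r).im = v * x₁.im + r * (√2 / 2) := by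
  simp [diagDir_im]; ring

theorem strip_base_norm_le {v : ℝ} (hv : v ∈ Icc (0 : ℝ) 1) (x₁ : ℂ) :
    ‖(0 : ℂ) + v * (x₁ - 0)‖ ≤ ‖x₁‖ := by
  rw [zero_add, sub_zero, norm_mul, Complex.norm_real, Real.norm_of_nonneg hv.1]
  exact mul_le_of_le_one_left (norm_nonneg _) hv.2

theorem norm_exp_pi_I_mul (c : ℝ) (x : ℂ) :
    ‖Complex.exp (Real.pi * Complex.I * c * x)‖ = Real.exp (-(Real.pi * c * x.im)) := by
  rw [Complex.norm_exp]
  congr 1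
  rw [show (Real.pi * Complex.I * c * x : ℂ) = ((Real.pi * c : ℝ) : ℂ) * (Complex.I * x) by
    push_cast; ring, Complex.re_ofReal_mul]
  simp

/-- The moments as integrals over a path from `0` to `x₁` followed by a parallel ray. -/
theorem rayMoment_path {s x₁ : ℂ} (hs : s.re < 0) (hx : 0 < x₁.re) (m : ℕ) :
    IntegrableOn (fun r : ℝ => saddleWeight s (diagDir * r) *
      Complex.exp (Real.pi * Complex.I * m * (diagDir * r))) (Ioi 0) ∧
    IntegrableOn (fun r : ℝ => saddleWeight s (x₁ + diagDir * r) *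
      Complex.exp (Real.pi * Complex.I * m * (x₁ + diagDir * r))) (Ioi 0) ∧
    diagDir * rayMoment s m =
      x₁ * (∫ v in (0 : ℝ)..1, saddleWeight s (v * x₁) *
        Complex.exp (Real.pi * Complex.I * m * (v * x₁))) +
      diagDir * ∫ r in Ioi (0 : ℝ), saddleWeight s (x₁ + diagDir * r) *
        Complex.exp (Real.pi * Complex.I * m * (x₁ + diagDir * r)) := by
  obtain ⟨C, hC0, hC⟩ := exists_saddleWeight_decay hs.le diagDir_sq ‖x₁‖
  have h2 : (0 : ℝ) < √2 / 2 := by positivity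
  have hp := Real.pi_pos
  have := ray_shift (a := 0) (b := x₁) (ω := diagDir)
    (F := fun x => saddleWeight s x * Complex.exp (Real.pi * Complex.I * m * x))
    (C := C * Real.exp (Real.pi * m * ‖x₁‖)) ?_ ?_ ?_
  · simpa only [rayMoment, zero_add, sub_zero] using this
  · intro v hv r hr
    refine (continuousAt_saddleWeight hs (Or.inl ?_)).mul (by fun_prop)
    rw [strip_re]
    have := mul_nonneg hv.1 hx.le
    positivity
  · intro v hv r hr
    refine (differentiableAt_saddleWeight (Or.inl ?_)).mul (by fun_prop)
    rw [strip_re]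
    have := mul_pos hv.1 hx
    positivity
  · intro v hv r hr
    have e1 := hC _ (strip_base_norm_le hv x₁) r (by linarith)
    have e2 := norm_exp_pi_I_mul (m : ℝ) (0 + v * (x₁ - 0) + diagDir * r)
    rw [Complex.ofReal_natCast] at e2
    rw [norm_mul, e2, mul_right_comm C]
    refine mul_le_mul e1 (Real.exp_le_exp.2 ?_) (Real.exp_pos _).le (by positivity)
    have e3 : -‖x₁‖ ≤ (0 + v * (x₁ - 0) + diagDir * r).im := by
      rw [strip_im]
      have h3 := Complex.abs_im_le_norm x₁
      have h4 := abs_le.1 h3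
      have h5 : 0 ≤ r * (√2 / 2) := by positivity
      have h6 := norm_nonneg x₁
      have h7 : v * ‖x₁‖ ≤ ‖x₁‖ := mul_le_of_le_one_left h6 hv.2
      nlinarith [mul_le_mul_of_nonneg_left h4.1 hv.1]
    have e4 : (0 : ℝ) ≤ Real.pi * m := by positivity
    nlinarith [mul_le_mul_of_nonneg_left e3 e4]

/-- The remainder of the geometric expansion of the integrand, over a deformed path. -/
theorem rayTail_path {s x₁ : ℂ} (hs : s.re < -1) (hx : 0 < x₁.im) (K : ℕ) :
    IntegrableOn (fun r : ℝ => saddleWeight s (diagDir * r) / sinDenom (diagDir * r) *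
      Complex.exp (Real.pi * Complex.I * (2 * K : ℕ) * (diagDir * r))) (Ioi 0) ∧
    diagDir * (∫ r in Ioi (0 : ℝ), saddleWeight s (diagDir * r) / sinDenom (diagDir * r) *
      Complex.exp (Real.pi * Complex.I * (2 * K : ℕ) * (diagDir * r))) =
      x₁ * (∫ v in (0 : ℝ)..1, saddleWeight s (v * x₁) / sinDenom (v * x₁) *
        Complex.exp (Real.pi * Complex.I * (2 * K : ℕ) * (v * x₁))) +
      diagDir * ∫ r in Ioi (0 : ℝ), saddleWeight s (x₁ + diagDir * r) /
        sinDenom (x₁ + diagDir * r) *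
        Complex.exp (Real.pi * Complex.I * (2 * K : ℕ) * (x₁ + diagDir * r)) := by
  obtain ⟨C, hC0, hC⟩ := exists_saddleWeight_decay (s := s) (by linarith) diagDir_sq ‖x₁‖
  have h2 : (0 : ℝ) < √2 / 2 := by positivity
  have hp := Real.pi_gt_three
  have := ray_shift (a := 0) (b := x₁) (ω := diagDir)
    (F := fun x => saddleWeight s x / sinDenom x *
      Complex.exp (Real.pi * Complex.I * (2 * K : ℕ) * x)) (C := C) ?_ ?_ ?_
  · obtain ⟨i1, -, e⟩ := this
    simp only [zero_add, sub_zero] at i1 e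
    exact ⟨i1, e⟩
  · intro v hv r hr
    refine (continuousAt_saddleWeight_div hs ?_).mul (by fun_prop)
    rw [strip_im, strip_re]
    have h3 : 0 ≤ r * (√2 / 2) := by positivity
    rcases hv.1.eq_or_lt with rfl | hv0
    · rcases hr.eq_or_lt with rfl | hr
      · right; simp
      · left; rw [zero_mul, zero_add]; positivity
    · left
      have := mul_pos hv0 hx
      positivity
  · intro v hv r hr
    refine (differentiableAt_saddleWeight_div (Or.inl ?_)).mul (by fun_prop)
    rw [strip_im]
    have := mul_pos hv.1 hx
    positivity
  · intro v hv r hr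
    have e1 := hC _ (strip_base_norm_le hv x₁) r (by linarith)
    have e2 := norm_exp_pi_I_mul ((2 * K : ℕ) : ℝ) (0 + v * (x₁ - 0) + diagDir * r)
    rw [Complex.ofReal_natCast] at e2
    have h1 : (1 : ℝ) ≤ √2 := by rw [Real.one_le_sqrt]; norm_num
    have e3 : 1 / 2 ≤ (0 + v * (x₁ - 0) + diagDir * r).im := by
      rw [strip_im]
      nlinarith [mul_nonneg hv.1 hx.le]
    have hD : 1 ≤ ‖sinDenom (0 + v * (x₁ - 0) + diagDir * r)‖ := by
      refine le_trans ?_ (two_pi_abs_im_le_norm_sinDenom _)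
      rw [abs_of_nonneg (by linarith)]
      nlinarith
    rw [norm_mul, e2, norm_div]
    refine (mul_le_of_le_one_right (by positivity) ?_).trans
      ((div_le_self (norm_nonneg _) hD).trans e1)
    rw [Real.exp_le_one_iff]
    have : (0 : ℝ) ≤ Real.pi * (2 * K : ℕ) := by positivity
    nlinarith

theorem geometric_expansion {x : ℂ} (hx : sinDenom x ≠ 0) (K : ℕ) :
    1 / sinDenom x = -(∑ k ∈ Finset.range K,
      Complex.exp (Real.pi * Complex.I * (2 * k + 1 : ℕ) * x)) +
      1 / sinDenom x * Complex.exp (Real.pi * Complex.I * (2 * K : ℕ) * x) := by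
  induction K with
  | zero => simp
  | succ K ih =>
    rw [Finset.sum_range_succ]
    have : Complex.exp (Real.pi * Complex.I * (2 * (K + 1) : ℕ) * x) -
        Complex.exp (Real.pi * Complex.I * (2 * K : ℕ) * x) =
        sinDenom x * Complex.exp (Real.pi * Complex.I * (2 * K + 1 : ℕ) * x) := by
      rw [sinDenom, sub_mul, ← Complex.exp_add, ← Complex.exp_add]
      push_cast
      congr 2 <;> ring
    have hc := mul_inv_cancel₀ hx
    rw [one_div] at ih ⊢
    linear_combination ih - (sinDenom x)⁻¹ * this -
      Complex.exp (Real.pi * Complex.I * (2 * K + 1 : ℕ) * x) * hc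

theorem ray_integral_eq_sum {s : ℂ} (hs : s.re < -1) (K : ℕ) :
    ∫ r in Ioi (0 : ℝ), saddleWeight s (diagDir * r) / sinDenom (diagDir * r) =
      -(∑ k ∈ Finset.range K, rayMoment s (2 * k + 1)) +
      ∫ r in Ioi (0 : ℝ), saddleWeight s (diagDir * r) / sinDenom (diagDir * r) *
        Complex.exp (Real.pi * Complex.I * (2 * K : ℕ) * (diagDir * r)) := by
  -- Only integrability along the original ray is needed here, so the corner `x₁` is an arbitrary
  -- admissible point.
  have hI : ∀ m : ℕ, IntegrableOn (fun r : ℝ => saddleWeight s (diagDir * r) *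
      Complex.exp (Real.pi * Complex.I * m * (diagDir * r))) (Ioi 0) := fun m =>
    (rayMoment_path (x₁ := 1) (by linarith) (by simp) m).1
  have hT := (rayTail_path (x₁ := Complex.I) hs (by simp) K).1
  simp only [rayMoment]
  have hS := (integrable_finsetSum (Finset.range K) fun k _ => hI (2 * k + 1)).neg
  rw [← integral_finsetSum _ fun k _ => hI (2 * k + 1), ← integral_neg]
  refine Eq.trans ?_ (integral_add hS hT)
  refine setIntegral_congr_fun measurableSet_Ioi fun r hr => ?_
  have hD : sinDenom (diagDir * r) ≠ 0 := by
    refine sinDenom_ne_zero (Or.inl ?_)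
    have : (0 : ℝ) < r := hr
    rw [Complex.im_mul_ofReal, diagDir_im]
    positivity
  have := geometric_expansion hD K
  simp only [← Finset.mul_sum]
  rw [div_eq_mul_one_div]
  nth_rewrite 1 [this]
  ring

/-! ### Size of the integrand on segments and near the saddle point -/

theorem norm_exp_pi_I_sq (x : ℂ) :
    ‖Complex.exp (Real.pi * Complex.I * x ^ 2)‖ = Real.exp (-(2 * Real.pi * x.re * x.im)) := by
  rw [Complex.norm_exp]
  congr 1
  rw [show (Real.pi * Complex.I * x ^ 2 : ℂ) = ((Real.pi : ℝ) : ℂ) * (Complex.I * (x * x)) by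
    ring, Complex.re_ofReal_mul]
  simp
  ring

theorem norm_saddleWeight_ofReal_mul {s x : ℂ} (hx : x ≠ 0) {v : ℝ} (hv : 0 < v) :
    ‖saddleWeight s (v * x)‖ = ‖saddleWeight s x‖ * (v ^ (-s.re) *
      Real.exp (2 * Real.pi * x.re * x.im * (1 - v ^ 2))) := by
  have hv' : (v : ℂ) ≠ 0 := by exact_mod_cast hv.ne'
  rw [saddleWeight, saddleWeight, norm_mul, norm_mul, norm_exp_pi_I_sq, norm_exp_pi_I_sq,
    Complex.norm_cpow_of_ne_zero (mul_ne_zero hv' hx), Complex.norm_cpow_of_ne_zero hx,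
    Complex.arg_real_mul x hv, norm_mul, Complex.norm_real, Real.norm_of_nonneg hv.le,
    Real.mul_rpow hv.le (norm_nonneg _), Complex.re_ofReal_mul, Complex.im_ofReal_mul,
    Complex.neg_re]
  have : Real.exp (-(2 * Real.pi * (v * x.re) * (v * x.im))) =
      Real.exp (-(2 * Real.pi * x.re * x.im)) *
        Real.exp (2 * Real.pi * x.re * x.im * (1 - v ^ 2)) := by
    rw [← Real.exp_add]; ring_nf
  rw [this]
  ring

theorem rpow_le_exp_mul_sub_one {v c : ℝ} (hv : 0 < v) (hc : 0 ≤ c) :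
    v ^ c ≤ Real.exp (c * (v - 1)) := by
  rw [Real.rpow_def_of_pos hv, Real.exp_le_exp, mul_comm]
  exact mul_le_mul_of_nonneg_left (Real.log_le_sub_one_of_pos hv) hc

/-- Along the segment from `0` to `x`, the integrand of a moment is largest at `x`. -/
theorem norm_momentIntegrand_segment_le {s x : ℂ} {m : ℕ} (hs : s.re < 0) (hx : 0 < x.re)
    (h : 4 * Real.pi * x.re * x.im + Real.pi * m * x.im ≤ -s.re) {v : ℝ} (hv : v ∈ Icc (0 : ℝ) 1) :
    ‖saddleWeight s (v * x) * Complex.exp (Real.pi * Complex.I * m * (v * x))‖ ≤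
      ‖saddleWeight s x * Complex.exp (Real.pi * Complex.I * m * x)‖ := by
  have hx0 : x ≠ 0 := by rintro rfl; simp at hx
  have hp := Real.pi_pos
  rcases hv.1.eq_or_lt with rfl | hv0
  · have : -s ≠ 0 := by
      intro h'; have := congrArg Complex.re h'; simp at this; linarith
    have h0 : saddleWeight s (((0 : ℝ) : ℂ) * x) = 0 := by
      rw [saddleWeight, Complex.ofReal_zero, zero_mul, Complex.zero_cpow this, zero_mul]
    rw [h0, zero_mul, norm_zero]
    exact norm_nonneg _
  · have e1 := norm_exp_pi_I_mul (m : ℝ) (v * x)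
    have e2 := norm_exp_pi_I_mul (m : ℝ) x
    rw [Complex.ofReal_natCast] at e1 e2
    rw [norm_mul, norm_mul, e1, e2, norm_saddleWeight_ofReal_mul hx0 hv0, mul_assoc]
    refine mul_le_mul_of_nonneg_left ?_ (norm_nonneg _)
    calc v ^ (-s.re) * Real.exp (2 * Real.pi * x.re * x.im * (1 - v ^ 2)) *
        Real.exp (-(Real.pi * m * (v * x).im))
        ≤ Real.exp (-s.re * (v - 1)) * Real.exp (2 * Real.pi * x.re * x.im * (1 - v ^ 2)) *
        Real.exp (-(Real.pi * m * (v * x).im)) := by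
          gcongr
          exact rpow_le_exp_mul_sub_one hv0 (by linarith)
      _ ≤ _ := by
          rw [← Real.exp_add, ← Real.exp_add, Real.exp_le_exp, Complex.im_ofReal_mul]
          -- The hypothesis `h` says that the logarithm of the modulus has nonnegative derivative at
          -- v = 1; the sign of `x.im` decides how it is extended to all v ≤ 1.
          have key : 0 ≤ (1 - v) * (-s.re - 2 * Real.pi * (x.re * x.im) * (1 + v)
              - Real.pi * m * x.im) := by
            refine mul_nonneg (by linarith [hv.2]) ?_
            rcases le_total 0 x.im with hy | hy
            · have : 0 ≤ 2 * Real.pi * (x.re * x.im) * (1 - v) :=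
                mul_nonneg (by positivity) (by linarith [hv.2])
              nlinarith
            · have h1 : 2 * Real.pi * (x.re * x.im) * (1 + v) ≤ 0 := by
                have : x.re * x.im ≤ 0 := mul_nonpos_of_nonneg_of_nonpos hx.le hy
                refine mul_nonpos_of_nonpos_of_nonneg ?_ (by linarith)
                exact mul_nonpos_of_nonneg_of_nonpos (by positivity) this
              have h2 : Real.pi * m * x.im ≤ 0 :=
                mul_nonpos_of_nonneg_of_nonpos (by positivity) hy
              linarith
          nlinarith

theorem log_mul_of_re_pos {x y : ℂ} (hx : 0 < x.re) (hy : 0 < y.re) :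
    Complex.log (x * y) = Complex.log x + Complex.log y := by
  have hx0 : x ≠ 0 := by rintro rfl; simp at hx
  have hy0 : y ≠ 0 := by rintro rfl; simp at hy
  have h1 := abs_lt.1 (Complex.abs_arg_lt_pi_div_two_iff.2 (Or.inl hx))
  have h2 := abs_lt.1 (Complex.abs_arg_lt_pi_div_two_iff.2 (Or.inl hy))
  rw [Complex.log_mul_eq_add_log_iff hx0 hy0]
  constructor <;> linarith

/-- The non-Gaussian part of the integrand near the saddle point `η`, at `η (1 + z)`. -/
noncomputable def saddleCorrection (η z : ℂ) : ℂ :=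
  Complex.exp (-(2 * Real.pi * Complex.I * η ^ 2) * (Complex.log (1 + z) - (z - z ^ 2 / 2))) /
    (1 + z)

/-- With 1 - s = -2πiη² the linear terms in z cancel. The quadratic terms of the logarithm and of
πix² contribute πi(ηz)² each, and the rest of the logarithm goes into the correction. -/
theorem saddleWeight_eq_gaussian_mul {s η z : ℂ} (hs : s = 1 + 2 * Real.pi * Complex.I * η ^ 2)
    (hη : 0 < η.re) (hz : 0 < (1 + z).re) :
    saddleWeight s (η * (1 + z)) = saddleWeight s η *
      Complex.exp (2 * Real.pi * Complex.I * (η * z) ^ 2) * saddleCorrection η z := by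
  have hη0 : η ≠ 0 := by rintro rfl; simp at hη
  have hz0 : 1 + z ≠ 0 := by intro h; rw [h] at hz; simp at hz
  have hinv : (1 + z)⁻¹ = Complex.exp (-Complex.log (1 + z)) := by
    rw [Complex.exp_neg, Complex.exp_log hz0]
  rw [saddleWeight, saddleWeight, saddleCorrection, div_eq_mul_inv, hinv,
    Complex.cpow_def_of_ne_zero (mul_ne_zero hη0 hz0), Complex.cpow_def_of_ne_zero hη0,
    log_mul_of_re_pos hη hz, ← Complex.exp_add, ← Complex.exp_add, ← Complex.exp_add,
    ← Complex.exp_add, ← Complex.exp_add]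
  congr 1
  rw [hs]
  ring

theorem norm_saddleCorrection_sub_one_le {η z : ℂ} (hz : ‖z‖ ≤ 1 / 2)
    (h : 5 * ‖η‖ ^ 2 * ‖z‖ ^ 3 ≤ 1) :
    ‖saddleCorrection η z - 1‖ ≤ 20 * ‖η‖ ^ 2 * ‖z‖ ^ 3 + 2 * ‖z‖ := by
  -- Third-order Taylor remainder of the logarithm, with 1/(1 - ‖z‖) ≤ 2.
  have hlog : ‖Complex.log (1 + z) - (z - z ^ 2 / 2)‖ ≤ 2 / 3 * ‖z‖ ^ 3 := by
    have := Complex.norm_log_sub_logTaylor_le 2 (z := z) (by linarith)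
    have ht : Complex.logTaylor (2 + 1) z = z - z ^ 2 / 2 := by
      simp [Complex.logTaylor_succ, Complex.logTaylor_zero]
      ring
    rw [ht] at this
    refine this.trans ?_
    have h2 : (1 - ‖z‖)⁻¹ ≤ 2 := by
      rw [inv_le_comm₀ (by linarith) two_pos]; linarith
    have h3 : ‖z‖ ^ (2 + 1) * (1 - ‖z‖)⁻¹ ≤ ‖z‖ ^ 3 * 2 :=
      mul_le_mul_of_nonneg_left h2 (by positivity)
    norm_num at h3 ⊢
    linarith
  set R := -(2 * Real.pi * Complex.I * η ^ 2) * (Complex.log (1 + z) - (z - z ^ 2 / 2)) with hR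
  have hRn : ‖R‖ ≤ 5 * ‖η‖ ^ 2 * ‖z‖ ^ 3 := by
    rw [hR, norm_mul, norm_neg, norm_mul, norm_mul, norm_mul, Complex.norm_I, norm_pow,
      Complex.norm_real, Real.norm_of_nonneg Real.pi_pos.le]
    norm_num
    have hp := Real.pi_lt_d2
    have hp0 := Real.pi_pos
    calc 2 * Real.pi * ‖η‖ ^ 2 * ‖Complex.log (1 + z) - (z - z ^ 2 / 2)‖
        ≤ 2 * Real.pi * ‖η‖ ^ 2 * (2 / 3 * ‖z‖ ^ 3) := by gcongr
      _ = 4 / 3 * Real.pi * (‖η‖ ^ 2 * ‖z‖ ^ 3) := by ring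
      _ ≤ 5 * (‖η‖ ^ 2 * ‖z‖ ^ 3) := by gcongr; linarith
      _ = _ := by ring
  have hexp := Complex.norm_exp_sub_one_le (x := R) (hRn.trans h)
  have h1z : 1 / 2 ≤ ‖1 + z‖ := by
    have := norm_sub_le_norm_add (1 : ℂ) z
    rw [norm_one] at this
    linarith
  have hne : 1 + z ≠ 0 := by intro h; rw [h, norm_zero] at h1z; norm_num at h1z
  have heq : saddleCorrection η z - 1 = (Complex.exp R - 1 - z) / (1 + z) := by
    rw [saddleCorrection, ← hR, eq_div_iff hne, sub_mul, div_mul_cancel₀ _ hne]; ring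
  rw [heq, norm_div, div_le_iff₀ (by linarith)]
  calc ‖Complex.exp R - 1 - z‖ ≤ 2 * ‖R‖ + ‖z‖ := (norm_sub_le _ _).trans (by linarith)
    _ ≤ (20 * ‖η‖ ^ 2 * ‖z‖ ^ 3 + 2 * ‖z‖) * (1 / 2) := by nlinarith
    _ ≤ _ := by gcongr

/-- The real part of `η² / (x y)` is nonnegative when `x / η` and `y / η` lie in the sector
`0 ≤ arg ≤ π / 4`. -/
theorem re_sq_div_mul_nonneg {η x y : ℂ} (hx : 0 ≤ (x / η).im) (hx' : (x / η).im ≤ (x / η).re)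
    (hy : 0 ≤ (y / η).im) (hy' : (y / η).im ≤ (y / η).re) : 0 ≤ (η ^ 2 / (x * y)).re := by
  have : η ^ 2 / (x * y) = ((x / η) * (y / η))⁻¹ := by
    rw [mul_inv, inv_div, inv_div]; ring
  rw [this, Complex.inv_re]
  refine div_nonneg ?_ (Complex.normSq_nonneg _)
  rw [Complex.mul_re]
  nlinarith [mul_le_mul hx' hy' hy (hx.trans hx')]

/-- The quotient is 1 - c/η + ωu/η. Since 0 < arg η < π/4, the last term lies in the sector 0 ≤ arg
≤ π/4. So does 1 - c/η, because c(Re η + Im η) ≤ |η|² when 2c ≤ |η|. The sector is closed under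
addition. -/
theorem sector_of_shift {η : ℂ} (hb : 0 < η.im) (hab : η.im < η.re) {c u : ℝ} (hc : 0 ≤ c)
    (hc' : 2 * c ≤ ‖η‖) (hu : 0 ≤ u) :
    0 ≤ ((η - c + diagDir * u) / η).im ∧
      ((η - c + diagDir * u) / η).im ≤ ((η - c + diagDir * u) / η).re := by
  have hη : 0 < ‖η‖ := norm_pos_iff.2 (by rintro rfl; simp at hb)
  have hre := Complex.re_le_norm η
  have hn : 0 < Complex.normSq η := by rw [Complex.normSq_eq_norm_sq]; positivity
  have hns : Complex.normSq η = η.re * η.re + η.im * η.im := Complex.normSq_apply η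
  have hns' : Complex.normSq η = ‖η‖ * ‖η‖ := by rw [Complex.normSq_eq_norm_sq]; ring
  have hX : (η - c + diagDir * u).re = η.re - c + √2 / 2 * u := by simp [diagDir_re]
  have hY : (η - c + diagDir * u).im = η.im + √2 / 2 * u := by simp [diagDir_im]
  have hk : 0 ≤ √2 / 2 * u := by positivity
  rw [Complex.div_im, Complex.div_re, hX, hY]
  set k := √2 / 2 * u
  constructor
  · rw [← sub_div]
    refine div_nonneg ?_ hn.le
    nlinarith [mul_nonneg hk (sub_nonneg.2 hab.le), mul_nonneg hc hb.le]
  · rw [← sub_div, ← add_div]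
    refine div_le_div_of_nonneg_right ?_ hn.le
    have h1 : c * (η.re + η.im) ≤ Complex.normSq η := by
      rw [hns']
      nlinarith [mul_le_mul hc' hre (by linarith) hη.le]
    rw [hns] at h1
    nlinarith [mul_nonneg hk hb.le]

/-- Gaussian decay of the integrand of a moment to the upper right of its saddle point. -/
theorem norm_momentIntegrand_ray_le {s η : ℂ} (hs : s = 1 + 2 * Real.pi * Complex.I * η ^ 2)
    (hb : 0 < η.im) (hab : η.im < η.re) {m : ℕ} (hm : (m / 4 : ℝ) < η.re)
    (hm₁ : (m : ℝ) ≤ 2 * ‖η‖) (hm₂ : Real.pi * m ^ 2 / 8 ≤ ‖η - (m / 4 : ℝ)‖)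
    {u : ℝ} (hu : 0 ≤ u) :
    ‖saddleWeight s (η - (m / 4 : ℝ) + diagDir * u) *
        Complex.exp (Real.pi * Complex.I * m * (η - (m / 4 : ℝ) + diagDir * u))‖ ≤
      ‖saddleWeight s (η - (m / 4 : ℝ)) *
        Complex.exp (Real.pi * Complex.I * m * (η - (m / 4 : ℝ)))‖ *
        Real.exp (u - Real.pi * u ^ 2) := by
  set y : ℂ := η - (m / 4 : ℝ) with hy
  have hyre : y.re = η.re - m / 4 := by rw [hy, Complex.sub_re, Complex.ofReal_re]
  have hyim : y.im = η.im := by rw [hy, Complex.sub_im, Complex.ofReal_im, sub_zero]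
  have hxre : ∀ u : ℝ, (y + diagDir * u).re = y.re + √2 / 2 * u := by
    intro u; simp [diagDir_re]
  have hxim : ∀ u : ℝ, (y + diagDir * u).im = y.im + √2 / 2 * u := by
    intro u; simp [diagDir_im]
  have hpos : ∀ u : ℝ, 0 ≤ u → 0 < (y + diagDir * u).re := by
    intro u hu
    rw [hxre, hyre]
    have : 0 ≤ √2 / 2 * u := by positivity
    linarith
  have hne : ∀ u : ℝ, 0 ≤ u → y + diagDir * u ≠ 0 := by
    intro u hu h
    have := hpos u hu
    rw [h] at this
    simp at this
  have hy0 : y ≠ 0 := by simpa using hne 0 le_rfl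
  -- A logarithm of x times the integrand. The extra factor x turns the exponent -s into 1 - s =
  -- -2πiη²; it is divided out at the end using `hyx`.
  let G : ℂ → ℂ := fun z => (1 - s) * Complex.log (y + diagDir * z) +
    Real.pi * Complex.I * (y + diagDir * z) ^ 2 + Real.pi * Complex.I * m * (y + diagDir * z)
  let G' : ℝ → ℂ := fun u => (1 - s) * (diagDir / (y + diagDir * u)) +
    Real.pi * Complex.I * (2 * (y + diagDir * u) * diagDir) + Real.pi * Complex.I * m * diagDir
  have hG : ∀ u : ℝ, 0 ≤ u → HasDerivAt G (G' u) u := by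
    intro u hu
    have h1 : HasDerivAt (fun z : ℂ => y + diagDir * z) diagDir (u : ℂ) := by
      simpa using ((hasDerivAt_id (u : ℂ)).const_mul diagDir).const_add y
    have h2 := (h1.clog (Or.inl (hpos u hu))).const_mul (1 - s)
    have h3 := (h1.pow 2).const_mul (Real.pi * Complex.I : ℂ)
    have h4 := h1.const_mul (Real.pi * Complex.I * m : ℂ)
    have := (h2.add h3).add h4
    refine this.congr_deriv ?_
    simp [G']
  have hG're : ∀ u : ℝ, 0 ≤ u → (G' u).re ≤ 1 - 2 * Real.pi * u := by
    intro u hu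
    have hx := hne u hu
    -- The first term is the value of the derivative at y, which is small since y is nearly
    -- critical. The second is the change from y to x, whose real part is at most -2πu by the sector
    -- argument.
    have heq : G' u = diagDir * (2 * Real.pi * Complex.I) * (-((m : ℂ) ^ 2 / 16) / y) -
        ((2 * Real.pi * u : ℝ) : ℂ) * (1 + η ^ 2 / ((y + diagDir * u) * y)) := by
      have hη : η = y + m / 4 := by rw [hy]; push_cast; ring
      have h1s : 1 - s = -(2 * Real.pi * Complex.I * (y + m / 4) ^ 2) := by
        rw [hs, hη]; ring
      simp only [G']
      rw [h1s, hη]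
      have hI : ((2 * Real.pi * u : ℝ) : ℂ) =
          -(2 * Real.pi * u * Complex.I * diagDir ^ 2) := by
        rw [diagDir_sq]; push_cast
        linear_combination (2 * Real.pi * u : ℂ) * Complex.I_sq
      rw [hI]
      field_simp
      ring
    have hsec := sector_of_shift hb hab (c := m / 4) (by positivity) (by linarith) hu
    have hsec0 := sector_of_shift hb hab (c := m / 4) (by positivity) (by linarith) le_rfl
    rw [Complex.ofReal_zero, mul_zero, add_zero, ← hy] at hsec0
    rw [← hy] at hsec
    have hnn := re_sq_div_mul_nonneg hsec.1 hsec.2 hsec0.1 hsec0.2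
    rw [heq, Complex.sub_re, Complex.re_ofReal_mul, Complex.add_re, Complex.one_re]
    have h5 : (diagDir * (2 * Real.pi * Complex.I) * (-((m : ℂ) ^ 2 / 16) / y)).re ≤ 1 := by
      refine (Complex.re_le_norm _).trans ?_
      have : ‖diagDir * (2 * Real.pi * Complex.I) * (-((m : ℂ) ^ 2 / 16) / y)‖ =
          (Real.pi * m ^ 2 / 8) / ‖y‖ := by
        simp only [norm_mul, norm_div, norm_neg, norm_pow, norm_diagDir, Complex.norm_I,
          Complex.norm_natCast, Complex.norm_real, Real.norm_of_nonneg Real.pi_pos.le]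
        norm_num
        ring
      rw [this, div_le_one (norm_pos_iff.2 hy0)]
      exact hm₂
    have h6 : 0 ≤ 2 * Real.pi * u * (η ^ 2 / ((y + diagDir * u) * y)).re :=
      mul_nonneg (by positivity) hnn
    linarith
  have hmono : AntitoneOn (fun u : ℝ => (G u).re - (u - Real.pi * u ^ 2)) (Ici 0) := by
    have hd : ∀ u : ℝ, 0 ≤ u → HasDerivAt (fun u : ℝ => (G u).re - (u - Real.pi * u ^ 2))
        ((G' u).re - (1 - Real.pi * (2 * u))) u := by
      intro u hu
      have h1 := (hG u hu).real_of_complex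
      have h2 := (hasDerivAt_id u).sub (((hasDerivAt_pow 2 u)).const_mul Real.pi)
      refine (h1.sub h2).congr_deriv ?_
      simp
    refine antitoneOn_of_hasDerivWithinAt_nonpos (f' := fun u => (G' u).re -
      (1 - Real.pi * (2 * u))) (convex_Ici 0) ?_ ?_ ?_
    · exact fun u hu => (hd u hu).continuousAt.continuousWithinAt
    · intro u hu
      rw [interior_Ici] at hu
      exact (hd u (le_of_lt hu)).hasDerivWithinAt
    · intro u hu
      rw [interior_Ici] at hu
      have := hG're u (le_of_lt hu)
      linarith
  have hle := hmono self_mem_Ici (mem_Ici.2 hu) hu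
  simp only at hle
  have hnorm : ∀ u : ℝ, 0 ≤ u → ‖saddleWeight s (y + diagDir * u) *
      Complex.exp (Real.pi * Complex.I * m * (y + diagDir * u))‖ =
      Real.exp (G u).re / ‖y + diagDir * u‖ := by
    intro u hu
    have hx := hne u hu
    rw [eq_div_iff (norm_ne_zero_iff.2 hx), ← norm_mul, ← Complex.norm_exp]
    congr 1
    simp only [G]
    rw [Complex.exp_add, Complex.exp_add, sub_mul, one_mul, sub_eq_add_neg, Complex.exp_add,
      Complex.exp_log hx, saddleWeight, Complex.cpow_def_of_ne_zero hx]
    rw [show Complex.log (y + diagDir * u) * -s = -(s * Complex.log (y + diagDir * u)) by ring]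
    ring
  have h0 := hnorm 0 le_rfl
  rw [Complex.ofReal_zero, mul_zero, add_zero] at h0
  rw [hnorm u hu, h0, div_mul_eq_mul_div, ← Real.exp_add]
  have hyx : ‖y‖ ≤ ‖y + diagDir * u‖ := by
    rw [Complex.norm_def, Complex.norm_def]
    apply Real.sqrt_le_sqrt
    rw [Complex.normSq_apply, Complex.normSq_apply, hxre, hxim]
    have h1 : 0 ≤ √2 / 2 * u := by positivity
    have h2 : 0 ≤ y.re := by rw [hyre]; linarith
    have h3 : 0 ≤ y.im := by rw [hyim]; exact hb.le
    nlinarith [mul_nonneg h1 h2, mul_nonneg h1 h3, mul_nonneg h1 h1]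
  refine div_le_div₀ (Real.exp_pos _).le (Real.exp_le_exp.2 ?_) (norm_pos_iff.2 hy0) hyx
  simp only [Complex.ofReal_zero] at hle
  nlinarith [hle]

/-! ### Saddle point estimate for each moment -/

/-- The value of the `m`-th moment predicted by the saddle point method, up to normalization. -/
noncomputable def momentFactor (η : ℂ) (m : ℕ) : ℂ :=
  Complex.exp (Real.pi * Complex.I * m * η - Real.pi * Complex.I * m ^ 2 / 8)

theorem norm_momentFactor (η : ℂ) (m : ℕ) :
    ‖momentFactor η m‖ = Real.exp (-(Real.pi * m * η.im)) := by
  have e1 := norm_exp_pi_I_mul (m : ℝ) η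
  rw [Complex.ofReal_natCast] at e1
  rw [momentFactor, sub_eq_add_neg, Complex.exp_add, norm_mul, e1,
    show -(Real.pi * Complex.I * m ^ 2 / 8 : ℂ) = ((-(Real.pi * m ^ 2 / 8) : ℝ) : ℂ) * Complex.I by
      push_cast; ring, Complex.norm_exp_ofReal_mul_I, mul_one]

/-- Approximation of the integrand of a moment near its saddle point. -/
theorem norm_momentIntegrand_sub_gaussian_le {s η : ℂ}
    (hs : s = 1 + 2 * Real.pi * Complex.I * η ^ 2) (hη : 0 < η.re) {K : ℕ} (hK : 100 ≤ K)
    (hK₂ : (K : ℝ) ^ 6 ≤ 4096 * ‖η‖) {m : ℕ} (hm : m ≤ 2 * K) {u : ℝ} (hu : |u| ≤ K) :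
    ‖saddleWeight s (η - (m / 4 : ℝ) + diagDir * u) *
        Complex.exp (Real.pi * Complex.I * m * (η - (m / 4 : ℝ) + diagDir * u)) -
      saddleWeight s η * momentFactor η m * Complex.exp (-(2 * Real.pi * u ^ 2))‖ ≤
      300000 / (K : ℝ) ^ 3 * (‖saddleWeight s η‖ * Real.exp (-(Real.pi * m * η.im)) *
        Real.exp (-(2 * Real.pi * u ^ 2))) := by
  have hKr : (100 : ℝ) ≤ K := by exact_mod_cast hK
  have hmr : (m : ℝ) ≤ 2 * K := by exact_mod_cast hm
  have hη0 : η ≠ 0 := by rintro rfl; simp at hη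
  have hP : 0 < ‖η‖ := norm_pos_iff.2 hη0
  set h : ℂ := -((m / 4 : ℝ) : ℂ) + diagDir * u with hh
  set z : ℂ := h / η with hz
  have hhn : ‖h‖ ≤ 3 / 2 * K := by
    refine (norm_add_le _ _).trans ?_
    rw [norm_neg, norm_mul, norm_diagDir, Complex.norm_real, Complex.norm_real, Real.norm_eq_abs,
      Real.norm_eq_abs, abs_of_nonneg (by positivity)]
    linarith
  have hzn : ‖z‖ ≤ 3 / 2 * K / ‖η‖ := by
    rw [hz, norm_div]; gcongr
  have hK6 : (100 : ℝ) ^ 5 * K ≤ K ^ 6 := by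
    calc (100 : ℝ) ^ 5 * K ≤ (K : ℝ) ^ 5 * K := by gcongr
      _ = _ := by ring
  have hz2 : ‖z‖ ≤ 1 / 2 := by
    refine hzn.trans ?_
    rw [div_le_iff₀ hP]
    linarith
  -- The cubic error |η|²|z|³ has size K³/|η|; this is where K⁶ ≤ 4096|η| makes it O(K^{-3}).
  have hK3 : (K : ℝ) ^ 3 / ‖η‖ ≤ 4096 / (K : ℝ) ^ 3 := by
    rw [div_le_div_iff₀ hP (by positivity)]
    calc (K : ℝ) ^ 3 * K ^ 3 = K ^ 6 := by ring
      _ ≤ _ := hK₂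
  have hK3' : (1000000 : ℝ) ≤ (K : ℝ) ^ 3 := by
    calc (1000000 : ℝ) = 100 ^ 3 := by norm_num
      _ ≤ _ := by gcongr
  have hz3 : ‖η‖ ^ 2 * ‖z‖ ^ 3 ≤ 27 / 8 * (K ^ 3 / ‖η‖) := by
    calc ‖η‖ ^ 2 * ‖z‖ ^ 3 ≤ ‖η‖ ^ 2 * (3 / 2 * K / ‖η‖) ^ 3 := by gcongr
      _ = _ := by field_simp; norm_num
  have hsmall : 4096 / (K : ℝ) ^ 3 ≤ 4096 / 1000000 := by gcongr
  have hcor := norm_saddleCorrection_sub_one_le (η := η) hz2 (by linarith)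
  -- The constant: (20 · 27/8 + 2 · 3/2) · 4096 = 288768.
  have hcor2 : ‖saddleCorrection η z - 1‖ ≤ 300000 / (K : ℝ) ^ 3 := by
    have h1 : (K : ℝ) / ‖η‖ ≤ K ^ 3 / ‖η‖ := by
      gcongr
      exact le_self_pow₀ (by linarith) (by norm_num)
    have h2 : 3 / 2 * (K : ℝ) / ‖η‖ = 3 / 2 * (K / ‖η‖) := by ring
    have h3 : 300000 / (K : ℝ) ^ 3 = 300000 / 4096 * (4096 / (K : ℝ) ^ 3) := by ring
    rw [h3]
    have h4 : 0 ≤ (K : ℝ) ^ 3 / ‖η‖ := by positivity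
    linarith
  have hzre : 0 < (1 + z).re := by
    have := Complex.abs_re_le_norm z
    have := abs_le.1 this
    rw [Complex.add_re, Complex.one_re]
    linarith
  have hηz : η * z = h := by rw [hz]; field_simp
  have hx : η - (m / 4 : ℝ) + diagDir * u = η * (1 + z) := by
    rw [mul_add, hηz, hh]; ring
  -- With h = ηz = -m/4 + ωu, completing the square gives 2πih² + πimh = 2πi(h + m/4)² - πim²/8, and
  -- 2πi(ωu)² = -2πu².
  have hgauss : Complex.exp (2 * Real.pi * Complex.I * (η * z) ^ 2) *
      Complex.exp (Real.pi * Complex.I * m * (η * (1 + z))) =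
      momentFactor η m * Complex.exp (-(2 * Real.pi * u ^ 2)) := by
    rw [momentFactor, ← Complex.exp_add, ← Complex.exp_add]
    congr 1
    rw [mul_add, hηz, hh]
    push_cast
    linear_combination (2 * Real.pi * Complex.I * u ^ 2) * diagDir_sq +
      (2 * Real.pi * u ^ 2) * Complex.I_sq
  have hmain : saddleWeight s (η - (m / 4 : ℝ) + diagDir * u) *
        Complex.exp (Real.pi * Complex.I * m * (η - (m / 4 : ℝ) + diagDir * u)) -
      saddleWeight s η * momentFactor η m * Complex.exp (-(2 * Real.pi * u ^ 2)) =
      (saddleCorrection η z - 1) *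
      (saddleWeight s η * momentFactor η m * Complex.exp (-(2 * Real.pi * u ^ 2))) := by
    rw [hx, saddleWeight_eq_gaussian_mul hs hη hzre]
    linear_combination (saddleWeight s η * saddleCorrection η z) * hgauss
  rw [hmain, norm_mul, norm_mul, norm_mul, norm_momentFactor]
  have hge : ‖Complex.exp (-(2 * Real.pi * u ^ 2))‖ = Real.exp (-(2 * Real.pi * u ^ 2)) := by
    rw [show (-(2 * Real.pi * u ^ 2) : ℂ) = ((-(2 * Real.pi * u ^ 2) : ℝ) : ℂ) by push_cast; ring,
      Complex.norm_exp_ofReal]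
  rw [hge]
  gcongr

theorem exp_neg_sq_le_inv_cube {K : ℝ} (hK : 2 ≤ K) : Real.exp (-K ^ 2) ≤ 1 / K ^ 3 := by
  rw [Real.exp_neg, one_div]
  refine inv_anti₀ (by positivity) ?_
  have := Real.quadratic_le_exp_of_nonneg (x := K ^ 2) (by positivity)
  nlinarith [mul_le_mul_of_nonneg_left hK (by positivity : 0 ≤ K ^ 3), sq_nonneg K]

theorem re_of_saddle {s η : ℂ} (hs : s = 1 + 2 * Real.pi * Complex.I * η ^ 2) :
    s.re = 1 - 4 * Real.pi * (η.re * η.im) := by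
  rw [hs, show (1 + 2 * Real.pi * Complex.I * η ^ 2 : ℂ) =
    1 + ((2 * Real.pi : ℝ) : ℂ) * (Complex.I * (η * η)) by push_cast; ring, Complex.add_re,
    Complex.re_ofReal_mul]
  simp
  ring

theorem norm_le_two_mul_re {η : ℂ} (hb : 0 < η.im) (hab : η.im < η.re) : ‖η‖ ≤ 2 * η.re := by
  refine (Complex.norm_le_abs_re_add_abs_im η).trans ?_
  rw [abs_of_pos hb, abs_of_pos (hb.trans hab)]
  linarith

theorem scale_le_norm {P : ℝ} {K : ℕ} (hK : 100 ≤ K) (hK₂ : (K : ℝ) ^ 6 ≤ 4096 * P) :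
    20000 * (K : ℝ) ^ 2 ≤ P := by
  have hKr : (100 : ℝ) ≤ K := by exact_mod_cast hK
  have hK6 : (100 : ℝ) ^ 4 * K ^ 2 ≤ K ^ 6 := by
    calc (100 : ℝ) ^ 4 * K ^ 2 ≤ (K : ℝ) ^ 4 * K ^ 2 := by gcongr
      _ = _ := by ring
  nlinarith [sq_nonneg (K : ℝ)]

theorem norm_gaussian_term (s η : ℂ) (m : ℕ) (u : ℝ) :
    ‖saddleWeight s η * momentFactor η m * Complex.exp (-(2 * Real.pi * u ^ 2))‖ =
      ‖saddleWeight s η‖ * Real.exp (-(Real.pi * m * η.im)) *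
        Real.exp (-(2 * Real.pi * u ^ 2)) := by
  have hge : ‖Complex.exp (-(2 * Real.pi * u ^ 2))‖ = Real.exp (-(2 * Real.pi * u ^ 2)) := by
    rw [show (-(2 * Real.pi * u ^ 2) : ℂ) = ((-(2 * Real.pi * u ^ 2) : ℝ) : ℂ) by
      push_cast; ring, Complex.norm_exp_ofReal]
  rw [norm_mul, norm_mul, norm_momentFactor, hge]

theorem norm_momentIntegrand_le {s η : ℂ}
    (hs : s = 1 + 2 * Real.pi * Complex.I * η ^ 2) (hη : 0 < η.re) {K : ℕ} (hK : 100 ≤ K)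
    (hK₂ : (K : ℝ) ^ 6 ≤ 4096 * ‖η‖) {m : ℕ} (hm : m ≤ 2 * K) {u : ℝ} (hu : |u| ≤ K) :
    ‖saddleWeight s (η - (m / 4 : ℝ) + diagDir * u) *
        Complex.exp (Real.pi * Complex.I * m * (η - (m / 4 : ℝ) + diagDir * u))‖ ≤
      2 * (‖saddleWeight s η‖ * Real.exp (-(Real.pi * m * η.im)) *
        Real.exp (-(2 * Real.pi * u ^ 2))) := by
  have hKr : (100 : ℝ) ≤ K := by exact_mod_cast hK
  have hK3' : (1000000 : ℝ) ≤ (K : ℝ) ^ 3 := by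
    calc (1000000 : ℝ) = 100 ^ 3 := by norm_num
      _ ≤ _ := by gcongr
  have hδ : 300000 / (K : ℝ) ^ 3 ≤ 1 := by
    rw [div_le_one (by positivity)]; linarith
  have h1 := norm_momentIntegrand_sub_gaussian_le hs hη hK hK₂ hm hu
  have h2 := norm_le_norm_add_norm_sub'
    (saddleWeight s (η - (m / 4 : ℝ) + diagDir * u) *
        Complex.exp (Real.pi * Complex.I * m * (η - (m / 4 : ℝ) + diagDir * u)))
    (saddleWeight s η * momentFactor η m * Complex.exp (-(2 * Real.pi * u ^ 2)))
  rw [norm_gaussian_term] at h2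
  have h3 : 0 ≤ ‖saddleWeight s η‖ * Real.exp (-(Real.pi * m * η.im)) *
      Real.exp (-(2 * Real.pi * u ^ 2)) := by positivity
  nlinarith [mul_le_mul_of_nonneg_right hδ h3]

theorem diagDir_re_bounds : 1 / 2 ≤ √2 / 2 ∧ √2 / 2 ≤ 1 := by
  have h1 : (1 : ℝ) ≤ √2 := by rw [Real.one_le_sqrt]; norm_num
  have h2 : √2 ≤ 2 := by rw [Real.sqrt_le_left (by norm_num)]; norm_num
  constructor <;> linarith

/-- The segment from the origin contributes a negligible amount to a moment. -/
theorem norm_moment_segment_le {s η : ℂ} (hs : s = 1 + 2 * Real.pi * Complex.I * η ^ 2)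
    (hs0 : s.re < 0) (hb : 0 < η.im) (hab : η.im < η.re) {K : ℕ} (hK : 100 ≤ K)
    (hK₁ : ‖η‖ ≤ (K : ℝ) ^ 6) (hK₂ : (K : ℝ) ^ 6 ≤ 4096 * ‖η‖) {m : ℕ} (hm : m ≤ 2 * K)
    {x₁ : ℂ} (hx₁ : x₁ = η - (m / 4 : ℝ) - diagDir * K) :
    0 < x₁.re ∧ ‖x₁ * ∫ v in (0 : ℝ)..1, saddleWeight s (v * x₁) *
        Complex.exp (Real.pi * Complex.I * m * (v * x₁))‖ ≤
      4 / (K : ℝ) ^ 3 * (‖saddleWeight s η‖ * Real.exp (-(Real.pi * m * η.im))) := by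
  have hKr : (100 : ℝ) ≤ K := by exact_mod_cast hK
  have hmr : (m : ℝ) ≤ 2 * K := by exact_mod_cast hm
  have ha : 0 < η.re := hb.trans hab
  have hp3 := Real.pi_gt_three
  have hPa := norm_le_two_mul_re hb hab
  have hPab : ‖η‖ ≤ η.re + η.im := by
    refine (Complex.norm_le_abs_re_add_abs_im η).trans ?_
    rw [abs_of_pos hb, abs_of_pos ha]
  have hPK := scale_le_norm hK hK₂
  have hK2 : 100 * (K : ℝ) ≤ K ^ 2 := by nlinarith
  -- The corner `x₁` lies a distance K back along the descent direction, at the parameter u = -K.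
  have hlocal := norm_momentIntegrand_le hs ha hK hK₂ hm (u := -K) (by simp)
  set E := Real.exp (-(Real.pi * m * η.im))
  set N := ‖saddleWeight s η‖
  have hN0 : 0 ≤ N := norm_nonneg _
  have hE0 : 0 < E := Real.exp_pos _
  obtain ⟨hk0, hk1⟩ := diagDir_re_bounds
  have hx₁re : x₁.re = η.re - m / 4 - √2 / 2 * K := by
    rw [hx₁]; simp [diagDir_re]
  have hx₁im : x₁.im = η.im - √2 / 2 * K := by
    rw [hx₁]; simp [diagDir_im]
  set d := √2 / 2 * K
  have hkK : d ≤ K := mul_le_of_le_one_left (by positivity) hk1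
  have hkK' : 1 ≤ d := by simp only [d]; nlinarith
  have hx₁pos : 0 < x₁.re := by rw [hx₁re]; linarith
  refine ⟨hx₁pos, ?_⟩
  set S := ∫ v in (0 : ℝ)..1, saddleWeight s (v * x₁) *
        Complex.exp (Real.pi * Complex.I * m * (v * x₁))
  have hx₁f : ‖saddleWeight s x₁ * Complex.exp (Real.pi * Complex.I * m * x₁)‖ ≤
      2 * (N * E) * Real.exp (-(6 * (K : ℝ) ^ 2)) := by
    have h2 : η - (m / 4 : ℝ) + diagDir * ((-K : ℝ) : ℂ) = x₁ := by rw [hx₁]; push_cast; ring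
    rw [h2] at hlocal
    refine hlocal.trans ?_
    have : Real.exp (-(2 * Real.pi * (-K : ℝ) ^ 2)) ≤ Real.exp (-(6 * (K : ℝ) ^ 2)) := by
      rw [Real.exp_le_exp, neg_sq]
      nlinarith [sq_nonneg (K : ℝ)]
    have hNE : 0 ≤ N * E := by positivity
    exact (mul_le_mul_of_nonneg_left (mul_le_mul_of_nonneg_left this hNE) two_pos.le).trans_eq
      (by ring)
  -- The terms in m cancel, since `x₁.re` contains -m/4. What remains is 4π d(Re η + Im η - d) ≥ 1.
  have hseg₀ : 4 * Real.pi * x₁.re * x₁.im + Real.pi * m * x₁.im ≤ -s.re := by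
    rw [re_of_saddle hs, hx₁re, hx₁im]
    have h3 : 1 * 1 ≤ d * (η.re + η.im - d) :=
      mul_le_mul hkK' (by linarith) zero_le_one (by linarith)
    have h4 : 1 * 1 ≤ Real.pi * (d * (η.re + η.im - d)) :=
      mul_le_mul (by linarith) (by linarith) zero_le_one (by linarith)
    linarith
  have hSn : ‖S‖ ≤ 2 * (N * E) * Real.exp (-(6 * (K : ℝ) ^ 2)) := by
    have := intervalIntegral.norm_integral_le_of_norm_le_const
      (a := (0 : ℝ)) (b := 1) (C := 2 * (N * E) * Real.exp (-(6 * (K : ℝ) ^ 2)))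
      (f := fun v : ℝ => saddleWeight s (v * x₁) *
        Complex.exp (Real.pi * Complex.I * m * (v * x₁))) (by
        intro v hv
        rw [uIoc_of_le zero_le_one] at hv
        exact (norm_momentIntegrand_segment_le hs0 hx₁pos hseg₀ ⟨hv.1.le, hv.2⟩).trans hx₁f)
    simpa using this
  have hx₁n : ‖x₁‖ ≤ 2 * (K : ℝ) ^ 6 := by
    have h1 : ‖x₁‖ ≤ ‖η - (m / 4 : ℝ)‖ + ‖diagDir * K‖ := by rw [hx₁]; exact norm_sub_le _ _
    have h2 : ‖η - (m / 4 : ℝ)‖ ≤ ‖η‖ + ‖((m / 4 : ℝ) : ℂ)‖ := norm_sub_le _ _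
    rw [Complex.norm_real, Real.norm_of_nonneg (by positivity)] at h2
    rw [norm_mul, norm_diagDir, Complex.norm_natCast] at h1
    linarith
  have hexpK := exp_neg_sq_le_inv_cube (K := K) (by linarith)
  -- The power K^{-9} beats the length of the segment, at most 2K⁶, and leaves K^{-3}.
  have hE3 : Real.exp (-(6 * (K : ℝ) ^ 2)) ≤ 1 / (K : ℝ) ^ 9 := by
    calc Real.exp (-(6 * (K : ℝ) ^ 2)) ≤ Real.exp (3 * (-(K : ℝ) ^ 2)) := by
          rw [Real.exp_le_exp]; nlinarith [sq_nonneg (K : ℝ)]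
      _ = Real.exp (-(K : ℝ) ^ 2) ^ 3 := by rw [← Real.exp_nat_mul]; norm_num
      _ ≤ (1 / (K : ℝ) ^ 3) ^ 3 := by gcongr
      _ = _ := by rw [div_pow, one_pow, ← pow_mul]
  calc ‖x₁ * S‖ ≤ 2 * (K : ℝ) ^ 6 * (2 * (N * E) * (1 / (K : ℝ) ^ 9)) := by
        rw [norm_mul]
        refine mul_le_mul hx₁n (hSn.trans ?_) (norm_nonneg _) (by positivity)
        gcongr
    _ = _ := by field_simp; ring

/-- The ray through the saddle point of a moment contributes a Gaussian integral. -/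
theorem norm_moment_ray_sub_le {s η : ℂ} (hs : s = 1 + 2 * Real.pi * Complex.I * η ^ 2)
    (hb : 0 < η.im) (hab : η.im < η.re) {K : ℕ} (hK : 100 ≤ K)
    (hK₂ : (K : ℝ) ^ 6 ≤ 4096 * ‖η‖) {m : ℕ} (hm : m ≤ 2 * K)
    {x₁ : ℂ} (hx₁ : x₁ = η - (m / 4 : ℝ) - diagDir * K)
    (hint : IntegrableOn (fun r : ℝ => saddleWeight s (x₁ + diagDir * r) *
      Complex.exp (Real.pi * Complex.I * m * (x₁ + diagDir * r))) (Ioi 0)) :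
    ‖(∫ r in Ioi (0 : ℝ), saddleWeight s (x₁ + diagDir * r) *
        Complex.exp (Real.pi * Complex.I * m * (x₁ + diagDir * r))) -
      saddleWeight s η * momentFactor η m * ((√(1 / 2) : ℝ) : ℂ)‖ ≤
      2 * (300000 / (K : ℝ) ^ 3 * (‖saddleWeight s η‖ * Real.exp (-(Real.pi * m * η.im)))) := by
  have hKr : (100 : ℝ) ≤ K := by exact_mod_cast hK
  have hmr : (m : ℝ) ≤ 2 * K := by exact_mod_cast hm
  have ha : 0 < η.re := hb.trans hab
  have hp3 := Real.pi_gt_three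
  have hp4 := Real.pi_lt_four
  have hPa := norm_le_two_mul_re hb hab
  have hPK := scale_le_norm hK hK₂
  have hK2 : 100 * (K : ℝ) ≤ K ^ 2 := by nlinarith
  have hexpK := exp_neg_sq_le_inv_cube (K := K) (by linarith)
  have hmain := norm_gaussian_term s η m
  set E := Real.exp (-(Real.pi * m * η.im)) with hE
  set N := ‖saddleWeight s η‖ with hN
  have hN0 : 0 ≤ N := norm_nonneg _
  have hE0 : 0 < E := Real.exp_pos _
  set y : ℂ := η - (m / 4 : ℝ) with hy
  set f : ℂ → ℂ := fun x => saddleWeight s x * Complex.exp (Real.pi * Complex.I * m * x) with hf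
  have hlocal : ∀ u : ℝ, |u| ≤ K → ‖f (y + diagDir * u) -
      saddleWeight s η * momentFactor η m * Complex.exp (-(2 * Real.pi * u ^ 2))‖ ≤
      300000 / (K : ℝ) ^ 3 * (N * E * Real.exp (-(2 * Real.pi * u ^ 2))) := fun u hu =>
    norm_momentIntegrand_sub_gaussian_le hs ha hK hK₂ hm hu
  have hfy : ‖f y‖ ≤ 2 * (N * E) := by
    have h := norm_momentIntegrand_le hs ha hK hK₂ hm (u := 0) (by simp)
    rw [Complex.ofReal_zero, mul_zero, add_zero, zero_pow two_ne_zero, mul_zero, neg_zero,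
      Real.exp_zero, mul_one] at h
    exact h
  have hyn : ‖η‖ / 2 ≤ ‖y‖ := by
    have h1 : ‖η‖ - ‖((m / 4 : ℝ) : ℂ)‖ ≤ ‖y‖ := norm_sub_norm_le _ _
    rw [Complex.norm_real, Real.norm_of_nonneg (by positivity)] at h1
    nlinarith
  have hright : ∀ u : ℝ, 0 ≤ u → ‖f (y + diagDir * u)‖ ≤
      2 * (N * E) * Real.exp (u - Real.pi * u ^ 2) := by
    intro u hu
    refine (norm_momentIntegrand_ray_le hs hb hab (m := m) (by nlinarith) (by nlinarith) ?_
      hu).trans ?_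
    · refine le_trans ?_ hyn
      have : (m : ℝ) ^ 2 ≤ (2 * K) ^ 2 := by gcongr
      nlinarith
    · gcongr
  have hgint : Integrable fun r : ℝ => saddleWeight s η * momentFactor η m *
      Complex.exp (-(2 * Real.pi * (r - K : ℝ) ^ 2)) := by
    have h1 : Integrable fun u : ℝ => Complex.exp (-(2 * Real.pi * u ^ 2)) := by
      have := (integrable_exp_neg_mul_sq (b := 2 * Real.pi) (by positivity)).ofReal (𝕜 := ℂ)
      refine this.congr (ae_of_all _ fun u => ?_)
      simp
    exact (h1.comp_sub_right (K : ℝ)).const_mul _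
  have hgval : ∫ r : ℝ, saddleWeight s η * momentFactor η m *
      Complex.exp (-(2 * Real.pi * (r - K : ℝ) ^ 2)) =
      saddleWeight s η * momentFactor η m * ((√(1 / 2) : ℝ) : ℂ) := by
    rw [integral_const_mul]
    congr 1
    rw [integral_sub_right_eq_self (fun u : ℝ => Complex.exp (-(2 * Real.pi * (u : ℂ) ^ 2)))]
    have h1 := integral_gaussian (2 * Real.pi)
    rw [show Real.pi / (2 * Real.pi) = 1 / 2 by field_simp] at h1
    rw [← h1, ← integral_complex_ofReal]
    refine integral_congr_ae (ae_of_all _ fun u => ?_)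
    simp
  set B := 300000 / (K : ℝ) ^ 3 * (N * E) with hB
  have hB0 : 0 ≤ B := by positivity
  rw [← hgval, ← integral_indicator measurableSet_Ioi, ← integral_sub
    ((integrable_indicator_iff measurableSet_Ioi).2 hint) hgint]
  -- The half line is compared with the full Gaussian by extending the integrand by zero. The single
  -- majorant B e^{-(r-K)²} covers all cases and has integral √π·B ≤ 2B.
  have hGI : Integrable fun r : ℝ => B * Real.exp (-1 * (r - K) ^ 2) :=
    ((integrable_exp_neg_mul_sq (b := 1) one_pos).comp_sub_right (K : ℝ)).const_mul B
  have hGV : ∫ r : ℝ, B * Real.exp (-1 * (r - K) ^ 2) ≤ 2 * B := by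
    rw [integral_const_mul, integral_sub_right_eq_self (fun u : ℝ => Real.exp (-1 * u ^ 2)),
      integral_gaussian, div_one, mul_comm]
    gcongr
    rw [Real.sqrt_le_left (by norm_num)]
    linarith
  refine (norm_integral_le_of_norm_le hGI (ae_of_all _ fun r => ?_)).trans hGV
  have hxu : x₁ + diagDir * r = y + diagDir * ((r - K : ℝ) : ℂ) := by
    rw [hx₁]; push_cast; ring
  set u : ℝ := r - K with hu
  have hfar : (K : ℝ) ≤ |u| → Real.exp (-(2 * u ^ 2)) ≤
      1 / (K : ℝ) ^ 3 * Real.exp (-1 * u ^ 2) := by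
    intro h
    rw [show -(2 * u ^ 2) = -u ^ 2 + -1 * u ^ 2 by ring, Real.exp_add]
    gcongr
    refine le_trans (Real.exp_le_exp.2 ?_) hexpK
    rw [← sq_abs u]
    gcongr
  have hNE : 0 ≤ N * E := by positivity
  -- Away from the window |u| ≤ K the integrand costs at most 2 and the Gaussian at most 1 of these
  -- units.
  have hBB : 3 * (N * E * (1 / (K : ℝ) ^ 3 * Real.exp (-1 * u ^ 2))) ≤
      B * Real.exp (-1 * u ^ 2) := by
    rw [hB]
    have : 0 ≤ N * E * (1 / (K : ℝ) ^ 3 * Real.exp (-1 * u ^ 2)) := by positivity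
    calc _ ≤ 300000 * (N * E * (1 / (K : ℝ) ^ 3 * Real.exp (-1 * u ^ 2))) := by linarith
      _ = _ := by ring
  have hexp2 : Real.exp (-(2 * Real.pi * u ^ 2)) ≤ Real.exp (-(2 * u ^ 2)) := by
    rw [Real.exp_le_exp]; nlinarith [sq_nonneg u]
  by_cases hr : 0 < r
  · rw [indicator_of_mem (mem_Ioi.2 hr)]
    change ‖f (x₁ + diagDir * r) - _‖ ≤ _
    rw [hxu]
    by_cases hr2 : |u| ≤ K
    · refine (hlocal u hr2).trans ?_
      rw [hB, mul_assoc _ (N * E)]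
      gcongr
      nlinarith [sq_nonneg u]
    · have hr2 := (not_le.1 hr2).le
      have hu0 : (K : ℝ) ≤ u := by
        rcases le_abs.1 hr2 with h | h
        · exact h
        · exfalso; linarith
      have e1 := hright u (by linarith)
      have e2 : Real.exp (u - Real.pi * u ^ 2) ≤ Real.exp (-(2 * u ^ 2)) := by
        rw [Real.exp_le_exp]; nlinarith
      refine (norm_sub_le _ _).trans ?_
      rw [hmain u]
      refine le_trans ?_ hBB
      have e3 := hfar hr2
      have e4 := mul_le_mul_of_nonneg_left (e2.trans e3) hNE
      have e5 := mul_le_mul_of_nonneg_left (hexp2.trans e3) hNE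
      linarith
  · rw [indicator_of_notMem (by simpa using hr), zero_sub, norm_neg, hmain u]
    refine le_trans ?_ hBB
    have hr2 : (K : ℝ) ≤ |u| := by rw [le_abs]; right; rw [hu]; linarith
    have e5 := mul_le_mul_of_nonneg_left (hexp2.trans (hfar hr2)) hNE
    have : 0 ≤ N * E * (1 / (K : ℝ) ^ 3 * Real.exp (-1 * u ^ 2)) := by positivity
    linarith

/-- Saddle point estimate for the moments. -/
theorem norm_rayMoment_sub_le {s η : ℂ} (hs : s = 1 + 2 * Real.pi * Complex.I * η ^ 2)
    (hs0 : s.re < 0) (hb : 0 < η.im) (hab : η.im < η.re) {K : ℕ} (hK : 100 ≤ K)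
    (hK₁ : ‖η‖ ≤ (K : ℝ) ^ 6) (hK₂ : (K : ℝ) ^ 6 ≤ 4096 * ‖η‖) {m : ℕ} (hm : m ≤ 2 * K) :
    ‖rayMoment s m - saddleWeight s η * momentFactor η m * ((√(1 / 2) : ℝ) : ℂ)‖ ≤
      1000000 / (K : ℝ) ^ 3 * (‖saddleWeight s η‖ * Real.exp (-(Real.pi * m * η.im))) := by
  obtain ⟨hx₁pos, hseg⟩ := norm_moment_segment_le hs hs0 hb hab hK hK₁ hK₂ hm rfl
  obtain ⟨-, hint, hpath⟩ := rayMoment_path hs0 hx₁pos m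
  have hdiff := norm_moment_ray_sub_le hs hb hab hK hK₂ hm rfl hint
  set x₁ : ℂ := η - (m / 4 : ℝ) - diagDir * K
  set S := ∫ v in (0 : ℝ)..1, saddleWeight s (v * x₁) *
        Complex.exp (Real.pi * Complex.I * m * (v * x₁))
  set J := ∫ r in Ioi (0 : ℝ), saddleWeight s (x₁ + diagDir * r) *
        Complex.exp (Real.pi * Complex.I * m * (x₁ + diagDir * r))
  have hA : rayMoment s m = diagDir⁻¹ * (x₁ * S) + J := by
    have hω := diagDir_ne_zero
    have h1 : diagDir * rayMoment s m = x₁ * S + diagDir * J := hpath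
    calc rayMoment s m = diagDir⁻¹ * (diagDir * rayMoment s m) := by
          rw [inv_mul_cancel_left₀ hω]
      _ = _ := by rw [h1, mul_add, inv_mul_cancel_left₀ hω]
  rw [hA, add_sub_assoc]
  refine (norm_add_le _ _).trans ?_
  rw [norm_mul, norm_inv, norm_diagDir, inv_one, one_mul]
  calc ‖x₁ * S‖ + _ ≤ _ + _ := add_le_add hseg hdiff
    _ = 600004 / (K : ℝ) ^ 3 *
        (‖saddleWeight s η‖ * Real.exp (-(Real.pi * m * η.im))) := by ring
    _ ≤ _ := by gcongr; norm_num

/-! ### The remainder of the geometric expansion -/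

/-- Here Λ = 2π Re η Im η, so that -s.re = 2Λ - 1, and κ = πK Im η. The division by v pays for the
lower bound v·Im η on the denominator. For v ≥ 1/2 the weight is at most 4 and e^{-2κv} ≤ e^{-κ}.
For v ≤ 1/2 the weight itself is at most 4e^{-(2 log 2 - 1)Λ}, which suffices because 2 log 2 - 1 >
1/4. -/
theorem tail_segment_bound {Λ v κ : ℝ} (hv : 0 < v) (hΛ : 1 ≤ Λ) (hκ : 0 ≤ κ)
    (hκΛ : κ ≤ Λ / 4) :
    v ^ (2 * Λ - 1) * Real.exp (Λ * (1 - v ^ 2)) * Real.exp (-(2 * κ * v)) / v ≤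
      4 * Real.exp (-κ) := by
  have hpow : v ^ (2 * Λ - 1) / v = v ^ (2 * Λ - 2) := by
    rw [← Real.rpow_sub_one hv.ne']; congr 1; ring
  have hrw : v ^ (2 * Λ - 1) * Real.exp (Λ * (1 - v ^ 2)) * Real.exp (-(2 * κ * v)) / v =
      v ^ (2 * Λ - 2) * Real.exp (Λ * (1 - v ^ 2)) * Real.exp (-(2 * κ * v)) := by
    rw [← hpow]; ring
  rw [hrw]
  rcases le_total (1 / 2) v with h | h
  · have h1 : v ^ (2 * Λ - 2) = v ^ (2 * Λ) / v ^ 2 := by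
      rw [Real.rpow_sub hv, Real.rpow_two]
    have h2 : v ^ (2 * Λ) ≤ Real.exp (Λ * (v ^ 2 - 1)) := by
      rw [Real.rpow_mul hv.le, Real.rpow_two]
      exact rpow_le_exp_mul_sub_one (by positivity) (by linarith)
    have h3 : v ^ (2 * Λ - 2) * Real.exp (Λ * (1 - v ^ 2)) ≤ 4 := by
      rw [h1, div_mul_eq_mul_div, div_le_iff₀ (by positivity)]
      calc v ^ (2 * Λ) * Real.exp (Λ * (1 - v ^ 2)) ≤
          Real.exp (Λ * (v ^ 2 - 1)) * Real.exp (Λ * (1 - v ^ 2)) := by gcongr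
        _ = 1 := by rw [← Real.exp_add]; ring_nf; exact Real.exp_zero
        _ ≤ _ := by nlinarith
    refine mul_le_mul h3 (Real.exp_le_exp.2 ?_) (Real.exp_pos _).le (by norm_num)
    nlinarith
  · have h1 : v ^ (2 * Λ - 2) ≤ (1 / 2 : ℝ) ^ (2 * Λ - 2) :=
      Real.rpow_le_rpow hv.le h (by linarith)
    have h2 : (1 / 2 : ℝ) ^ (2 * Λ - 2) = 4 * Real.exp (-(Λ * (2 * Real.log 2))) := by
      rw [Real.rpow_sub (by norm_num), Real.rpow_two, Real.rpow_def_of_pos (by norm_num), one_div,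
        Real.log_inv]
      norm_num
      rw [div_eq_mul_inv]
      norm_num
      rw [mul_comm]
      congr 2
      ring
    have hlog := Real.log_two_gt_d9
    calc v ^ (2 * Λ - 2) * Real.exp (Λ * (1 - v ^ 2)) * Real.exp (-(2 * κ * v))
        ≤ 4 * Real.exp (-(Λ * (2 * Real.log 2))) * Real.exp Λ * 1 := by
          rw [← h2]
          gcongr
          · nlinarith [sq_nonneg v]
          · rw [Real.exp_le_one_iff]
            have : 0 ≤ 2 * κ * v := by positivity
            linarith
      _ = 4 * Real.exp (-(Λ * (2 * Real.log 2)) + Λ) := by rw [Real.exp_add]; ring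
      _ ≤ _ := by
          gcongr
          nlinarith

/-- The remainder of the geometric expansion is exponentially small. -/
theorem norm_rayTail_le {s η : ℂ} (hs : s = 1 + 2 * Real.pi * Complex.I * η ^ 2)
    (hs1 : s.re < -1) (hb : 0 < η.im) (hab : η.im < η.re) {K : ℕ} (hK : 100 ≤ K)
    (hK₁ : ‖η‖ ≤ (K : ℝ) ^ 6) (hK₂ : (K : ℝ) ^ 6 ≤ 4096 * ‖η‖) :
    ‖∫ r in Ioi (0 : ℝ), saddleWeight s (diagDir * r) / sinDenom (diagDir * r) *
      Complex.exp (Real.pi * Complex.I * (2 * K : ℕ) * (diagDir * r))‖ ≤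
      7 * (K : ℝ) ^ 6 / η.im * Real.exp (-(Real.pi * K * η.im)) * ‖saddleWeight s η‖ := by
  have hKr : (100 : ℝ) ≤ K := by exact_mod_cast hK
  have ha : 0 < η.re := hb.trans hab
  have hη0 : η ≠ 0 := by rintro rfl; simp at hb
  have hp3 := Real.pi_gt_three
  have hPa := norm_le_two_mul_re hb hab
  have hPK := scale_le_norm hK hK₂
  have hσ := re_of_saddle hs
  -- The path turns at η itself, so it stays in the open upper half plane apart from its start at 0,
  -- and on the ray the denominator is at least Im η.
  obtain ⟨-, hpath⟩ := rayTail_path hs1 hb K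
  set N := ‖saddleWeight s η‖
  set X := Real.exp (-(Real.pi * K * η.im))
  have hX0 : 0 < X := Real.exp_pos _
  have hN0 : 0 ≤ N := norm_nonneg _
  set T := ∫ r in Ioi (0 : ℝ), saddleWeight s (diagDir * r) / sinDenom (diagDir * r) *
      Complex.exp (Real.pi * Complex.I * (2 * K : ℕ) * (diagDir * r))
  have hexp : ∀ x : ℂ, ‖Complex.exp (Real.pi * Complex.I * (2 * K : ℕ) * x)‖ =
      Real.exp (-(2 * (Real.pi * K) * x.im)) := by
    intro x
    have := norm_exp_pi_I_mul ((2 * K : ℕ) : ℝ) x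
    rw [Complex.ofReal_natCast] at this
    rw [this]
    congr 1
    push_cast
    ring
  have hseg : ‖∫ v in (0 : ℝ)..1, saddleWeight s (v * η) / sinDenom (v * η) *
        Complex.exp (Real.pi * Complex.I * (2 * K : ℕ) * (v * η))‖ ≤ 4 * N * X / η.im := by
    have := intervalIntegral.norm_integral_le_of_norm_le_const
      (a := (0 : ℝ)) (b := 1) (C := 4 * N * X / η.im)
      (f := fun v : ℝ => saddleWeight s (v * η) / sinDenom (v * η) *
        Complex.exp (Real.pi * Complex.I * (2 * K : ℕ) * (v * η))) (by
        intro v hv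
        rw [uIoc_of_le zero_le_one] at hv
        have hv0 := hv.1
        have hbd := tail_segment_bound (Λ := 2 * Real.pi * η.re * η.im) (κ := Real.pi * K * η.im)
          hv0 (by linarith) (by positivity) (by
            have h1 : 2 * (K : ℝ) ≤ η.re := by nlinarith
            have h2 : 0 ≤ Real.pi * η.im := by positivity
            nlinarith [mul_le_mul_of_nonneg_left h1 h2])
        have hD : v * η.im ≤ ‖sinDenom (v * η)‖ := by
          refine le_trans ?_ (two_pi_abs_im_le_norm_sinDenom _)
          rw [Complex.im_ofReal_mul, abs_of_pos (by positivity)]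
          have : 0 < v * η.im := by positivity
          nlinarith
        rw [norm_mul, norm_div, hexp, norm_saddleWeight_ofReal_mul hη0 hv0, Complex.im_ofReal_mul]
        have hσ' : -s.re = 2 * (2 * Real.pi * η.re * η.im) - 1 := by rw [hσ]; ring
        rw [hσ']
        set Q := v ^ (2 * (2 * Real.pi * η.re * η.im) - 1) *
          Real.exp (2 * Real.pi * η.re * η.im * (1 - v ^ 2)) with hQ
        have hQ0 : 0 ≤ Q := by positivity
        calc N * Q / ‖sinDenom (v * η)‖ * Real.exp (-(2 * (Real.pi * K) * (v * η.im)))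
            ≤ N * Q / (v * η.im) * Real.exp (-(2 * (Real.pi * K) * (v * η.im))) := by
              gcongr
          _ = N / η.im * (Q * Real.exp (-(2 * (Real.pi * K * η.im) * v)) / v) := by
              rw [show 2 * (Real.pi * K) * (v * η.im) = 2 * (Real.pi * K * η.im) * v by ring]
              field_simp
          _ ≤ N / η.im * (4 * X) := by gcongr
          _ = _ := by ring)
    simpa using this
  have hray : ‖∫ r in Ioi (0 : ℝ), saddleWeight s (η + diagDir * r) /
        sinDenom (η + diagDir * r) *
        Complex.exp (Real.pi * Complex.I * (2 * K : ℕ) * (η + diagDir * r))‖ ≤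
      3 * N * X / η.im := by
    have hGI : IntegrableOn (fun r : ℝ => N * X / η.im * Real.exp 1 * Real.exp (-r)) (Ioi 0) :=
      (integrableOn_exp_neg_Ioi 0).const_mul _
    have hGV : ∫ r in Ioi (0 : ℝ), N * X / η.im * Real.exp 1 * Real.exp (-r) ≤
        3 * N * X / η.im := by
      rw [integral_const_mul, integral_exp_neg_Ioi_zero, mul_one]
      have := Real.exp_one_lt_d9
      have h0 : 0 ≤ N * X / η.im := by positivity
      calc N * X / η.im * Real.exp 1 ≤ N * X / η.im * 3 := by gcongr; linarith
        _ = _ := by ring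
    refine (norm_integral_le_of_norm_le hGI ?_).trans hGV
    refine (ae_restrict_iff' measurableSet_Ioi).2 (ae_of_all _ fun r hr => ?_)
    have hr0 : (0 : ℝ) < r := hr
    have hW := norm_momentIntegrand_ray_le hs hb hab (m := 0) (by simpa using ha) (by simp)
      (by simp) hr0.le
    simp only [Nat.cast_zero, zero_div, Complex.ofReal_zero, sub_zero, mul_zero, zero_mul,
      Complex.exp_zero, mul_one] at hW
    have him : η.im ≤ (η + diagDir * r).im := by
      rw [Complex.add_im, Complex.im_mul_ofReal, diagDir_im]
      have : 0 ≤ √2 / 2 * r := by positivity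
      linarith
    have hD : η.im ≤ ‖sinDenom (η + diagDir * r)‖ := by
      refine le_trans ?_ (two_pi_abs_im_le_norm_sinDenom _)
      rw [abs_of_nonneg (by linarith)]
      nlinarith
    rw [norm_mul, norm_div, hexp]
    calc ‖saddleWeight s (η + diagDir * r)‖ / ‖sinDenom (η + diagDir * r)‖ *
        Real.exp (-(2 * (Real.pi * K) * (η + diagDir * r).im))
        ≤ N * Real.exp (1 - r) / η.im * X := by
          gcongr
          · refine hW.trans (mul_le_mul_of_nonneg_left (Real.exp_le_exp.2 ?_) hN0)
            nlinarith [sq_nonneg (r - 1), sq_nonneg r]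
          · refine Real.exp_le_exp.2 ?_
            have h1 : 0 ≤ Real.pi * K := by positivity
            have h2 : 0 ≤ Real.pi * K * η.im := by positivity
            nlinarith [mul_le_mul_of_nonneg_left him h1]
      _ = _ := by rw [sub_eq_add_neg, Real.exp_add]; ring
  have hT : ‖T‖ = ‖diagDir * T‖ := by rw [norm_mul, norm_diagDir, one_mul]
  rw [hT, hpath]
  refine (norm_add_le _ _).trans ?_
  rw [norm_mul, norm_mul, norm_diagDir, one_mul]
  have hK6 : (1 : ℝ) ≤ (K : ℝ) ^ 6 := one_le_pow₀ (by linarith)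
  calc _ ≤ (K : ℝ) ^ 6 * (4 * N * X / η.im) + 3 * N * X / η.im :=
        add_le_add (mul_le_mul hK₁ hseg (norm_nonneg _) (by positivity)) hray
    _ ≤ (K : ℝ) ^ 6 * (4 * N * X / η.im) + (K : ℝ) ^ 6 * (3 * N * X / η.im) := by
        gcongr
        exact le_mul_of_one_le_left (by positivity) hK6
    _ = _ := by ring

/-! ### Summing the saddle point values -/

/-- Since (4j+1)² = 16j² + 8j + 1, the phase e^{-πim²/8} reduces to e^{-πi/8}(-1)^j. -/
theorem momentFactor_four_mul_add_one (η : ℂ) (j : ℕ) :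
    momentFactor η (4 * j + 1) = Complex.exp (-(Real.pi * Complex.I / 8)) *
      (Complex.exp (Real.pi * Complex.I * η) * (-Complex.exp (Real.pi * Complex.I * η) ^ 4) ^ j) := by
  have h1 : -Complex.exp (Real.pi * Complex.I * η) ^ 4 =
      Complex.exp (4 * (Real.pi * Complex.I * η) - Real.pi * Complex.I) := by
    rw [Complex.exp_sub, Complex.exp_pi_mul_I, ← Complex.exp_nat_mul]
    push_cast; ring
  rw [h1, ← Complex.exp_nat_mul, ← Complex.exp_add, ← Complex.exp_add, momentFactor,
    Complex.exp_eq_exp_iff_exists_int]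
  refine ⟨-(j : ℤ) ^ 2, ?_⟩
  push_cast
  ring

/-- Since (4j+3)² = 16j² + 24j + 9, the phase reduces to -e^{-πi/8}(-1)^j. -/
theorem momentFactor_four_mul_add_three (η : ℂ) (j : ℕ) :
    momentFactor η (4 * j + 3) = -(Complex.exp (-(Real.pi * Complex.I / 8)) *
      (Complex.exp (Real.pi * Complex.I * η) ^ 3 *
        (-Complex.exp (Real.pi * Complex.I * η) ^ 4) ^ j)) := by
  have h1 : -Complex.exp (Real.pi * Complex.I * η) ^ 4 =
      Complex.exp (4 * (Real.pi * Complex.I * η) - Real.pi * Complex.I) := by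
    rw [Complex.exp_sub, Complex.exp_pi_mul_I, ← Complex.exp_nat_mul]
    push_cast; ring
  rw [h1, ← Complex.exp_nat_mul, ← Complex.exp_nat_mul, ← Complex.exp_add, ← Complex.exp_add,
    ← neg_one_mul, ← Complex.exp_pi_mul_I, ← Complex.exp_add, momentFactor,
    Complex.exp_eq_exp_iff_exists_int]
  refine ⟨-(j : ℤ) ^ 2 - j - 1, ?_⟩
  push_cast
  ring

/-- The saddle point values of the moments add up to a quotient of trigonometric functions. -/
theorem sum_momentFactor {η : ℂ} (hη : 0 < η.im) (L : ℕ) :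
    ∑ k ∈ Finset.range (2 * L), momentFactor η (2 * k + 1) =
      Complex.exp (-(Real.pi * Complex.I / 8)) * (-Complex.I) *
        (Complex.sin (Real.pi * η) / Complex.cos (2 * Real.pi * η)) *
        (1 - (-Complex.exp (Real.pi * Complex.I * η) ^ 4) ^ L) := by
  set q := Complex.exp (Real.pi * Complex.I * η) with hq
  have hq0 : q ≠ 0 := Complex.exp_ne_zero _
  have hqn : ‖q‖ < 1 := by
    have := norm_exp_pi_I_mul 1 η
    rw [Complex.ofReal_one, mul_one, mul_one] at this
    rw [hq, this, Real.exp_lt_one_iff, neg_lt_zero]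
    have := Real.pi_pos
    positivity
  have h4 : 1 + q ^ 4 ≠ 0 := by
    intro h
    have h1 : q ^ 4 = -1 := by linear_combination h
    have h2 : ‖q‖ ^ 4 = 1 := by rw [← norm_pow, h1, norm_neg, norm_one]
    have h3 : ‖q‖ ^ 4 < 1 := pow_lt_one₀ (norm_nonneg _) hqn (by norm_num)
    linarith
  -- Consecutive odd m pair up to (q - q³)(-q⁴)^j, so an even number of terms telescopes after
  -- multiplication by 1 + q⁴.
  have hsum : (1 + q ^ 4) * ∑ k ∈ Finset.range (2 * L), momentFactor η (2 * k + 1) =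
      Complex.exp (-(Real.pi * Complex.I / 8)) * (q - q ^ 3) * (1 - (-q ^ 4) ^ L) := by
    induction L with
    | zero => simp
    | succ L ih =>
      rw [show 2 * (L + 1) = 2 * L + 1 + 1 by ring, Finset.sum_range_succ, Finset.sum_range_succ,
        show 2 * (2 * L) + 1 = 4 * L + 1 by ring, show 2 * (2 * L + 1) + 1 = 4 * L + 3 by ring,
        momentFactor_four_mul_add_one, momentFactor_four_mul_add_three, ← hq, pow_succ _ L]
      linear_combination ih
  have hqi : Complex.exp (-(Real.pi * Complex.I * η)) = q⁻¹ := Complex.exp_neg _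
  have hsin : Complex.sin (Real.pi * η) = (q⁻¹ - q) * Complex.I / 2 := by
    rw [Complex.sin, neg_mul, show Real.pi * η * Complex.I = Real.pi * Complex.I * η by ring, hqi]
  have hcos : Complex.cos (2 * Real.pi * η) = (q ^ 2 + (q⁻¹) ^ 2) / 2 := by
    rw [Complex.cos, neg_mul,
      show 2 * Real.pi * η * Complex.I = (2 : ℕ) * (Real.pi * Complex.I * η) by push_cast; ring,
      ← mul_neg, Complex.exp_nat_mul, Complex.exp_nat_mul, hqi]
  have hcos' : q ^ 2 + (q⁻¹) ^ 2 = (1 + q ^ 4) / q ^ 2 := by field_simp; ring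
  have hratio : (-Complex.I) * (Complex.sin (Real.pi * η) / Complex.cos (2 * Real.pi * η)) =
      (q - q ^ 3) / (1 + q ^ 4) := by
    rw [hsin, hcos, hcos']
    field_simp
    linear_combination (q ^ 2 - 1) * Complex.I_sq
  rw [mul_assoc (Complex.exp _), hratio]
  field_simp
  linear_combination hsum

/-- With y = π Im η, |sin πη| ≥ sinh y ≥ y e^y/(1 + 2y) and |cos 2πη| ≤ e^{2y}. The factor 1/`η.im`
reflects the zeros of sin on the real axis. -/
theorem sin_div_cos_lower {η : ℂ} (hη : 0 < η.im) :
    Real.exp (-(Real.pi * η.im)) ≤ (2 + 1 / η.im) *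
      ‖Complex.sin (Real.pi * η) / Complex.cos (2 * Real.pi * η)‖ := by
  have hp3 := Real.pi_gt_three
  set y := Real.pi * η.im with hy
  have hy0 : 0 < y := by positivity
  have hsin : y * Real.exp y / (1 + 2 * y) ≤ ‖Complex.sin (Real.pi * η)‖ := by
    have h1 : ‖sinDenom η‖ = 2 * ‖Complex.sin (Real.pi * η)‖ := by
      rw [sinDenom_eq_sin, norm_mul, norm_mul, Complex.norm_I]; norm_num
    have h2 : Real.exp y - Real.exp (-y) ≤ ‖sinDenom η‖ := by
      have e1 := norm_exp_pi_I_mul 1 η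
      have e2 := norm_exp_pi_I_mul (-1) η
      rw [Complex.ofReal_one, mul_one, mul_one, ← hy] at e1
      have e3 : (Real.pi * Complex.I * ((-1 : ℝ) : ℂ) * η) = -(Real.pi * Complex.I * η) := by
        push_cast; ring
      rw [e3, show -(Real.pi * -1 * η.im) = y by rw [hy]; ring] at e2
      rw [sinDenom, norm_sub_rev, ← e1, ← e2]
      exact norm_sub_norm_le _ _
    have h3 : Real.exp (-y) ≤ Real.exp y / (1 + 2 * y) := by
      rw [le_div_iff₀ (by positivity)]
      calc Real.exp (-y) * (1 + 2 * y) ≤ Real.exp (-y) * Real.exp (2 * y) := by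
            gcongr
            linarith [Real.add_one_le_exp (2 * y)]
        _ = Real.exp y := by rw [← Real.exp_add]; ring_nf
    have h4 : Real.exp y - Real.exp y / (1 + 2 * y) = 2 * (y * Real.exp y / (1 + 2 * y)) := by
      field_simp; ring
    linarith
  have hcos : ‖Complex.cos (2 * Real.pi * η)‖ ≤ Real.exp (2 * y) := by
    have e1 := norm_exp_pi_I_mul 2 η
    have e2 := norm_exp_pi_I_mul (-2) η
    have e3 : (Real.pi * Complex.I * ((2 : ℝ) : ℂ) * η) = 2 * Real.pi * η * Complex.I := by
      push_cast; ring
    have e4 : (Real.pi * Complex.I * ((-2 : ℝ) : ℂ) * η) = -(2 * Real.pi * η) * Complex.I := by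
      push_cast; ring
    rw [e3, show -(Real.pi * 2 * η.im) = -(2 * y) by rw [hy]; ring] at e1
    rw [e4, show -(Real.pi * -2 * η.im) = 2 * y by rw [hy]; ring] at e2
    rw [Complex.cos, norm_div]
    have h1 := norm_add_le (Complex.exp (2 * Real.pi * η * Complex.I))
      (Complex.exp (-(2 * Real.pi * η) * Complex.I))
    rw [e1, e2] at h1
    have h2 : Real.exp (-(2 * y)) ≤ Real.exp (2 * y) := by
      rw [Real.exp_le_exp]; linarith
    rw [show ‖(2 : ℂ)‖ = 2 by norm_num]
    linarith
  have hcos0 : 0 < ‖Complex.cos (2 * Real.pi * η)‖ := by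
    rw [norm_pos_iff]
    intro h
    obtain ⟨k, hk⟩ := Complex.cos_eq_zero_iff.1 h
    have := congrArg Complex.im hk
    rw [show (2 * Real.pi * η : ℂ) = ((2 * Real.pi : ℝ) : ℂ) * η by push_cast; ring,
      Complex.im_ofReal_mul, show ((2 * k + 1) * Real.pi / 2 : ℂ) =
      (((2 * k + 1) * Real.pi / 2 : ℝ) : ℂ) by push_cast; ring, Complex.ofReal_im] at this
    have : 0 < 2 * Real.pi * η.im := by positivity
    linarith
  rw [norm_div]
  calc Real.exp (-y) = (1 + 2 * y) / y * (y * Real.exp y / (1 + 2 * y) / Real.exp (2 * y)) := by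
        field_simp
        rw [← Real.exp_add]; ring_nf
    _ ≤ (1 + 2 * y) / y *
        (‖Complex.sin (Real.pi * η)‖ / ‖Complex.cos (2 * Real.pi * η)‖) := by
        gcongr
    _ ≤ _ := by
        gcongr
        rw [show (1 + 2 * y) / y = 2 + 1 / y by field_simp; ring]
        gcongr
        rw [hy]
        nlinarith

/-! ### Total relative error -/

/-- The relative error in the saddle point approximation, in terms of the number of terms. -/
noncomputable def saddleError (K : ℝ) : ℝ :=
  2 * (Real.exp (-(1 / 16) * K ^ (1 / 7 : ℝ)) + 17000000 / K + 1000000 / K ^ 3 +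
    1904 * (K ^ 8 * Real.exp (-(1 / 16) * K ^ (1 / 7 : ℝ))))

theorem tendsto_saddleError : Tendsto saddleError atTop (𝓝 0) := by
  have hK : Tendsto (fun K : ℝ => K ^ (1 / 7 : ℝ)) atTop atTop :=
    tendsto_rpow_atTop (by norm_num)
  have h1 : Tendsto (fun K : ℝ => Real.exp (-(1 / 16) * K ^ (1 / 7 : ℝ))) atTop (𝓝 0) := by
    have := (tendsto_rpow_mul_exp_neg_mul_atTop_nhds_zero 0 (1 / 16) (by norm_num)).comp hK
    refine this.congr fun K => ?_
    simp
  have h2 : Tendsto (fun K : ℝ => 17000000 / K) atTop (𝓝 0) := tendsto_const_nhds.div_atTop tendsto_id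
  have h3 : Tendsto (fun K : ℝ => 1000000 / K ^ 3) atTop (𝓝 0) :=
    tendsto_const_nhds.div_atTop (tendsto_pow_atTop (by norm_num))
  have h4 : Tendsto (fun K : ℝ => K ^ 8 * Real.exp (-(1 / 16) * K ^ (1 / 7 : ℝ))) atTop (𝓝 0) := by
    have := (tendsto_rpow_mul_exp_neg_mul_atTop_nhds_zero 56 (1 / 16) (by norm_num)).comp hK
    refine this.congr' ?_
    filter_upwards [eventually_ge_atTop 0] with K hK0
    simp only [Function.comp]
    rw [← Real.rpow_mul hK0, show (1 / 7 : ℝ) * 56 = (8 : ℕ) by norm_num, Real.rpow_natCast]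
  have := (((h1.add h2).add h3).add (h4.const_mul 1904)).const_mul 2
  simp only [mul_zero, add_zero] at this
  exact this

/-- Four errors are collected: the truncation of the geometric series, the sum of the moment errors,
the remainder, and the replacement of W·2^{-1/2} by the moment m = 0. Each is measured against
|W|·|sin πη / cos 2πη|, and |W| ≤ 2|`rayMoment s 0`|. The number of terms K = 2L is even so that odd
m pair up. -/
theorem norm_ray_integral_sub_le {s η : ℂ} (hs : s = 1 + 2 * Real.pi * Complex.I * η ^ 2)
    (hb : 0 < η.im) (hab : η.im < η.re) {L : ℕ} (hL : 100 ≤ L)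
    (hK₁ : ‖η‖ ≤ ((2 * L : ℕ) : ℝ) ^ 6) (hK₂ : ((2 * L : ℕ) : ℝ) ^ 6 ≤ 4096 * ‖η‖)
    (hbK : 1 ≤ 16 * η.im * ((2 * L : ℕ) : ℝ) ^ (6 / 7 : ℝ)) :
    ‖(∫ r in Ioi (0 : ℝ), saddleWeight s (diagDir * r) / sinDenom (diagDir * r)) -
      rayMoment s 0 * (Complex.I * Complex.exp (-(Real.pi * Complex.I / 8)) *
        (Complex.sin (Real.pi * η) / Complex.cos (2 * Real.pi * η)))‖ ≤
      saddleError ((2 * L : ℕ) : ℝ) *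
      ‖rayMoment s 0 * (Complex.I * Complex.exp (-(Real.pi * Complex.I / 8)) *
        (Complex.sin (Real.pi * η) / Complex.cos (2 * Real.pi * η)))‖ := by
  set K : ℕ := 2 * L with hKdef
  have hK200 : 200 ≤ K := by omega
  have hKr : (200 : ℝ) ≤ K := by exact_mod_cast hK200
  have hp3 := Real.pi_gt_three
  have ha : 0 < η.re := hb.trans hab
  have hPa := norm_le_two_mul_re hb hab
  have hPK := scale_le_norm (by omega) hK₂
  have hK0 : (0 : ℝ) < K := by linarith
  have hKb : (K : ℝ) ^ (1 / 7 : ℝ) ≤ 16 * (K * η.im) := by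
    have h1 : (K : ℝ) = K ^ (6 / 7 : ℝ) * K ^ (1 / 7 : ℝ) := by
      rw [← Real.rpow_add hK0]; norm_num
    calc (K : ℝ) ^ (1 / 7 : ℝ) ≤ (16 * η.im * (K : ℝ) ^ (6 / 7 : ℝ)) * (K : ℝ) ^ (1 / 7 : ℝ) :=
          le_mul_of_one_le_left (by positivity) hbK
      _ = 16 * ((K ^ (6 / 7 : ℝ) * K ^ (1 / 7 : ℝ)) * η.im) := by ring
      _ = _ := by rw [← h1]
  have hKb1 : 1 ≤ 16 * (K * η.im) :=
    (Real.one_le_rpow (by linarith) (by norm_num)).trans hKb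
  have hbinv : 1 / η.im ≤ 16 * K := by
    rw [div_le_iff₀ hb]; linarith
  have hs1 : s.re < -1 := by
    rw [re_of_saddle hs]
    have h1 : 10000 * (K : ℝ) ^ 2 * η.im ≤ η.re * η.im := by gcongr; linarith
    have h2 : 1 ≤ (K : ℝ) ^ 2 * η.im := by nlinarith
    nlinarith
  have hmom : ∀ m : ℕ, m ≤ 2 * K → _ := fun m hm =>
    norm_rayMoment_sub_le hs (by linarith) hb hab (m := m) (by omega) hK₁ hK₂ hm
  have htail := norm_rayTail_le hs hs1 hb hab (by omega) hK₁ hK₂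
  have hdecomp := ray_integral_eq_sum hs1 K
  have hclosed := sum_momentFactor hb L
  rw [← hKdef] at hclosed
  have hlow := sin_div_cos_lower hb
  set A := ∫ r in Ioi (0 : ℝ), saddleWeight s (diagDir * r) / sinDenom (diagDir * r)
  set T := ∫ r in Ioi (0 : ℝ), saddleWeight s (diagDir * r) / sinDenom (diagDir * r) *
        Complex.exp (Real.pi * Complex.I * (2 * K : ℕ) * (diagDir * r))
  set S := Complex.sin (Real.pi * η) / Complex.cos (2 * Real.pi * η)
  set w := Complex.exp (-(Real.pi * Complex.I / 8)) with hw
  have hwn : ‖w‖ = 1 := by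
    rw [hw, show (-(Real.pi * Complex.I / 8) : ℂ) = ((-(Real.pi / 8) : ℝ) : ℂ) * Complex.I by
      push_cast; ring, Complex.norm_exp_ofReal_mul_I]
  set M := Complex.I * w * S with hM
  have hMn : ‖M‖ = ‖S‖ := by rw [hM, norm_mul, norm_mul, hwn, Complex.norm_I, one_mul, one_mul]
  set W := saddleWeight s η
  set κ : ℂ := ((√(1 / 2) : ℝ) : ℂ)
  set p := (-Complex.exp (Real.pi * Complex.I * η) ^ 4) ^ L with hp
  set X := Real.exp (-(1 / 16) * (K : ℝ) ^ (1 / 7 : ℝ)) with hX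
  set b := η.im
  have hXK : Real.exp (-(K * b)) ≤ X := by
    rw [hX, Real.exp_le_exp]; linarith
  have hpn : ‖p‖ ≤ X := by
    have h1 := norm_exp_pi_I_mul 1 η
    rw [Complex.ofReal_one, mul_one, mul_one] at h1
    rw [hp, norm_pow, norm_neg, norm_pow, h1, ← pow_mul, ← Real.exp_nat_mul]
    refine le_trans (Real.exp_le_exp.2 ?_) hXK
    have h2 : ((4 * L : ℕ) : ℝ) = 2 * K := by rw [hKdef]; push_cast; ring
    rw [h2]
    have : 0 ≤ K * b := by positivity
    nlinarith
  have hκn : ‖κ‖ ≤ 1 := by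
    rw [Complex.norm_real, Real.norm_of_nonneg (Real.sqrt_nonneg _), Real.sqrt_le_iff]
    norm_num
  have hκn' : 0.7 ≤ ‖κ‖ := by
    rw [Complex.norm_real, Real.norm_of_nonneg (Real.sqrt_nonneg _)]
    apply Real.le_sqrt_of_sq_le
    norm_num
  have hmf0 : momentFactor η 0 = 1 := by simp [momentFactor]
  have hA0 := hmom 0 (by omega)
  rw [hmf0, mul_one] at hA0
  simp only [Nat.cast_zero, mul_zero, zero_mul, neg_zero, Real.exp_zero, mul_one] at hA0
  have hW0 : 0 ≤ ‖W‖ := norm_nonneg _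
  have hA0low : ‖W‖ / 2 ≤ ‖rayMoment s 0‖ := by
    have h1 : ‖W * κ‖ - ‖rayMoment s 0‖ ≤ ‖rayMoment s 0 - W * κ‖ := by
      rw [norm_sub_rev]; exact norm_sub_norm_le _ _
    have h2 : 1000000 / (K : ℝ) ^ 3 ≤ 0.125 := by
      rw [div_le_iff₀ (by positivity)]
      have : (200 : ℝ) ^ 3 ≤ K ^ 3 := by gcongr
      linarith
    rw [norm_mul] at h1
    nlinarith [mul_le_mul_of_nonneg_left hκn' hW0, mul_le_mul_of_nonneg_right h2 hW0]
  -- The four errors, in the order truncation, moments, remainder, normalization.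
  have hid : A - rayMoment s 0 * M = -(W * κ * M * p) -
      (∑ k ∈ Finset.range K, (rayMoment s (2 * k + 1) - W * momentFactor η (2 * k + 1) * κ)) + T -
      (rayMoment s 0 - W * κ) * M := by
    rw [hdecomp, Finset.sum_sub_distrib, ← Finset.sum_mul, ← Finset.mul_sum, hclosed, hM]
    ring
  have hsum : ‖∑ k ∈ Finset.range K,
      (rayMoment s (2 * k + 1) - W * momentFactor η (2 * k + 1) * κ)‖ ≤
      1000000 / (K : ℝ) ^ 2 * (‖W‖ * Real.exp (-(Real.pi * b))) := by
    calc _ ≤ ∑ k ∈ Finset.range K, 1000000 / (K : ℝ) ^ 3 * (‖W‖ * Real.exp (-(Real.pi * b))) := by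
          refine norm_sum_le_of_le _ fun k hk => ?_
          have hk' := Finset.mem_range.1 hk
          refine (hmom (2 * k + 1) (by omega)).trans ?_
          gcongr
          push_cast
          have : 0 ≤ Real.pi * k * b := by positivity
          nlinarith
      _ = _ := by
          rw [Finset.sum_const, Finset.card_range, nsmul_eq_mul]
          field_simp
  have hSpos : 0 ≤ ‖S‖ := norm_nonneg _
  -- 2 + 1/b ≤ 2 + 16K ≤ 17K.
  have hlow2 : Real.exp (-(Real.pi * b)) ≤ 17 * K * ‖S‖ := by
    refine hlow.trans ?_
    gcongr
    linarith
  -- 1904 = 7 · 16 · 17. One factor e^{-πb} is split off e^{-πKb} for comparison with the main term;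
  -- the rest is still at most e^{-Kb} ≤ X.
  have hT2 : ‖T‖ ≤ 1904 * (K ^ 8 * X) * (‖W‖ * ‖S‖) := by
    refine htail.trans ?_
    have h1 : Real.exp (-(Real.pi * K * b)) ≤ X * (17 * K * ‖S‖) := by
      calc Real.exp (-(Real.pi * K * b)) ≤ Real.exp (-(K * b)) * Real.exp (-(Real.pi * b)) := by
            rw [← Real.exp_add, Real.exp_le_exp]
            have : 200 * b ≤ K * b := by gcongr
            nlinarith [mul_pos hK0 hb]
        _ ≤ _ := by gcongr
    have h2 : 7 * (K : ℝ) ^ 6 / b ≤ 7 * (K : ℝ) ^ 6 * (16 * K) := by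
      rw [div_eq_mul_one_div]; gcongr
    calc 7 * (K : ℝ) ^ 6 / b * Real.exp (-(Real.pi * K * b)) * ‖W‖
        ≤ 7 * (K : ℝ) ^ 6 * (16 * K) * (X * (17 * K * ‖S‖)) * ‖W‖ := by gcongr
      _ = _ := by ring
  have hsum2 : 1000000 / (K : ℝ) ^ 2 * (‖W‖ * Real.exp (-(Real.pi * b))) ≤
      17000000 / K * (‖W‖ * ‖S‖) := by
    calc _ ≤ 1000000 / (K : ℝ) ^ 2 * (‖W‖ * (17 * K * ‖S‖)) := by gcongr
      _ = _ := by field_simp; ring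
  have hfirst : ‖W * κ * M * p‖ ≤ X * (‖W‖ * ‖S‖) := by
    rw [norm_mul, norm_mul, norm_mul, hMn]
    calc ‖W‖ * ‖κ‖ * ‖S‖ * ‖p‖ ≤ ‖W‖ * 1 * ‖S‖ * X := by gcongr
      _ = _ := by ring
  have hlast : ‖(rayMoment s 0 - W * κ) * M‖ ≤ 1000000 / (K : ℝ) ^ 3 * (‖W‖ * ‖S‖) := by
    rw [norm_mul, hMn, ← mul_assoc]
    gcongr
  have htot : ‖A - rayMoment s 0 * M‖ ≤ saddleError K / 2 * (‖W‖ * ‖S‖) := by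
    rw [hid]
    refine (norm_sub_le _ _).trans ?_
    refine (add_le_add (norm_add_le _ _) le_rfl).trans ?_
    refine (add_le_add (add_le_add (norm_sub_le _ _) le_rfl) le_rfl).trans ?_
    rw [norm_neg]
    have : saddleError K / 2 * (‖W‖ * ‖S‖) = X * (‖W‖ * ‖S‖) + 17000000 / K * (‖W‖ * ‖S‖) +
        1904 * (K ^ 8 * X) * (‖W‖ * ‖S‖) + 1000000 / (K : ℝ) ^ 3 * (‖W‖ * ‖S‖) := by
      rw [saddleError]; ring
    rw [this]
    gcongr
    exact hsum.trans hsum2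
  refine htot.trans ?_
  rw [norm_mul, hMn]
  have hE0 : 0 ≤ saddleError K := by rw [saddleError]; positivity
  calc saddleError K / 2 * (‖W‖ * ‖S‖) = saddleError K * (‖W‖ / 2 * ‖S‖) := by ring
    _ ≤ _ := by gcongr

/-! ### The size of η in the region -/

theorem saddle_of_etaRoot (s : ℂ) : s = 1 + 2 * Real.pi * Complex.I * etaRoot s ^ 2 := by
  have hp : (Real.pi : ℂ) ≠ 0 := by exact_mod_cast Real.pi_ne_zero
  rw [etaRoot_sq]
  field_simp
  ring

theorem etaRoot_im_pos {s : ℂ} (hs : s ∈ farLeftRegion) :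
    0 < (etaRoot s).im ∧ (etaRoot s).im < (etaRoot s).re := by
  obtain ⟨h1, h2⟩ := etaRoot_arg s hs
  have hp := Real.pi_pos
  have hne : etaRoot s ≠ 0 := by
    intro h; rw [h, Complex.arg_zero] at h1; exact lt_irrefl _ h1
  have hn : 0 < ‖etaRoot s‖ := norm_pos_iff.2 hne
  rw [← Complex.norm_mul_sin_arg (etaRoot s), ← Complex.norm_mul_cos_arg (etaRoot s)]
  refine ⟨mul_pos hn (Real.sin_pos_of_pos_of_lt_pi h1 (by linarith)),
    mul_lt_mul_of_pos_left ?_ hn⟩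
  calc Real.sin (etaRoot s).arg < Real.sin (Real.pi / 4) :=
        Real.sin_lt_sin_of_lt_of_le_pi_div_two (by linarith) (by linarith) h2
    _ = Real.cos (Real.pi / 4) := by rw [Real.sin_pi_div_four, Real.cos_pi_div_four]
    _ < Real.cos (etaRoot s).arg := Real.cos_lt_cos_of_nonneg_of_le_pi h1.le (by linarith) h2

theorem norm_etaRoot_sq (s : ℂ) : 2 * Real.pi * ‖etaRoot s‖ ^ 2 = ‖s - 1‖ := by
  rw [← norm_pow, etaRoot_sq, norm_div, norm_mul, norm_mul, Complex.norm_I, Complex.norm_real,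
    Real.norm_of_nonneg Real.pi_pos.le]
  have := Real.pi_pos
  norm_num
  field_simp

/-- In the region, `Im η` decays at most like `|η|^{-1/7}`. -/
theorem one_le_etaRoot_im_mul {s : ℂ} (hs : s ∈ farLeftRegion) (h1 : 1 ≤ ‖etaRoot s‖) :
    1 ≤ 16 * (etaRoot s).im * ‖etaRoot s‖ ^ (1 / 7 : ℝ) := by
  obtain ⟨hb, hab⟩ := etaRoot_im_pos hs
  have hsq := norm_etaRoot_sq s
  have hσ := re_of_saddle (saddle_of_etaRoot s)
  obtain ⟨ht, hst⟩ := hs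
  have hp3 := Real.pi_gt_three
  have hp4 := Real.pi_lt_four
  set η := etaRoot s
  set P := ‖η‖
  have hP0 : 0 < P := by linarith
  have haP : η.re ≤ P := Complex.re_le_norm η
  have hsum : ‖s - 1‖ ≤ (1 - s.re) + s.im := by
    refine (Complex.norm_le_abs_re_add_abs_im _).trans ?_
    have hr : s.re < 0 := by have := Real.rpow_pos_of_pos ht (3 / 7); linarith
    rw [Complex.sub_re, Complex.sub_im, Complex.one_re, Complex.one_im, sub_zero, abs_of_pos ht,
      abs_of_neg (by linarith)]
    linarith
  have hab' : 1 - s.re ≤ 4 * Real.pi * (P * η.im) := by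
    rw [hσ]
    have : η.re * η.im ≤ P * η.im := by gcongr
    nlinarith
  have hP7 : 1 ≤ P ^ (1 / 7 : ℝ) := Real.one_le_rpow h1 (by norm_num)
  have hPb : 0 < P * η.im := by positivity
  -- Since 2πP² = |s - 1| ≤ (1 - σ) + t, either t ≥ πP², and then P^{6/7} ≤ t^{3/7} ≤ -σ ≤ 4πP Im η,
  -- or 1 - σ ≥ πP², and then Im η ≥ P/4.
  rcases le_total (Real.pi * P ^ 2) s.im with h | h
  · have h2 : P ^ (6 / 7 : ℝ) ≤ s.im ^ (3 / 7 : ℝ) := by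
      have e1 : P ^ (6 / 7 : ℝ) = (P ^ 2) ^ (3 / 7 : ℝ) := by
        rw [← Real.rpow_natCast, ← Real.rpow_mul hP0.le]; norm_num
      rw [e1]
      exact Real.rpow_le_rpow (by positivity) (by nlinarith) (by norm_num)
    have h3 : P ^ (6 / 7 : ℝ) ≤ 16 * (P * η.im) := by nlinarith
    have h4 : P = P ^ (6 / 7 : ℝ) * P ^ (1 / 7 : ℝ) := by
      rw [← Real.rpow_add hP0]; norm_num
    have h5 : P * 1 ≤ P * (16 * η.im * P ^ (1 / 7 : ℝ)) := by
      calc P * 1 = P ^ (6 / 7 : ℝ) * P ^ (1 / 7 : ℝ) := by rw [mul_one, ← h4]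
        _ ≤ 16 * (P * η.im) * P ^ (1 / 7 : ℝ) := by gcongr
        _ = _ := by ring
    exact le_of_mul_le_mul_left h5 hP0
  · have h2 : Real.pi * P ^ 2 ≤ 4 * Real.pi * (P * η.im) := by linarith
    have h3 : P ≤ 4 * η.im := by
      have h4 : (Real.pi * P) * P ≤ (Real.pi * P) * (4 * η.im) := by linarith
      exact le_of_mul_le_mul_left h4 (by positivity)
    nlinarith

theorem exists_even_scale {P : ℝ} (hP : 1 ≤ P) :
    ∃ L : ℕ, P ^ (1 / 6 : ℝ) ≤ L ∧ P ≤ ((2 * L : ℕ) : ℝ) ^ 6 ∧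
      ((2 * L : ℕ) : ℝ) ^ 6 ≤ 4096 * P := by
  have hQ : 1 ≤ P ^ (1 / 6 : ℝ) := Real.one_le_rpow hP (by norm_num)
  have hQ6 : (P ^ (1 / 6 : ℝ)) ^ 6 = P := by
    rw [← Real.rpow_natCast, ← Real.rpow_mul (by linarith)]; norm_num
  set Q := P ^ (1 / 6 : ℝ)
  have h1 : Q ≤ ⌈Q⌉₊ := Nat.le_ceil Q
  have h2 : (⌈Q⌉₊ : ℝ) < Q + 1 := Nat.ceil_lt_add_one (by linarith)
  -- The bound 2⌈Q⌉ ≤ 4Q gives 4⁶ = 4096.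
  refine ⟨⌈Q⌉₊, h1, ?_, ?_⟩
  · rw [← hQ6]
    gcongr
    push_cast
    linarith
  · calc ((2 * ⌈Q⌉₊ : ℕ) : ℝ) ^ 6 ≤ (4 * Q) ^ 6 := by
          gcongr
          push_cast
          linarith
      _ = 4096 * Q ^ 6 := by ring
      _ = _ := by rw [hQ6]

theorem tendsto_norm_etaRoot : Tendsto (fun s => ‖etaRoot s‖) (cobounded ℂ) atTop := by
  have h1 : Tendsto (fun s : ℂ => ‖s‖) (cobounded ℂ) atTop := tendsto_norm_cobounded_atTop
  have hp := Real.pi_pos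
  refine tendsto_atTop.2 fun B => ?_
  filter_upwards [h1.eventually_ge_atTop (2 * Real.pi * B ^ 2 + 1)] with s hs
  have h2 := norm_etaRoot_sq s
  have h3 : ‖s‖ - 1 ≤ ‖s - 1‖ := by
    have := norm_sub_norm_le s 1
    rwa [norm_one] at this
  have h4 : B ^ 2 ≤ ‖etaRoot s‖ ^ 2 := by
    have : 2 * Real.pi * B ^ 2 ≤ 2 * Real.pi * ‖etaRoot s‖ ^ 2 := by linarith
    exact le_of_mul_le_mul_left this (by positivity)
  exact le_of_sq_le_sq h4 (norm_nonneg _)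

/-- In the region, the ray integral is asymptotic to its saddle point approximation. -/
theorem eventually_norm_ray_integral_sub_le (c : ℝ) (hc : 0 < c) :
    ∀ᶠ s in cobounded ℂ ⊓ 𝓟 farLeftRegion, s.re < -1 ∧
    ‖(∫ r in Ioi (0 : ℝ), saddleWeight s (diagDir * r) / sinDenom (diagDir * r)) -
      rayMoment s 0 * (Complex.I * Complex.exp (-(Real.pi * Complex.I / 8)) *
        (Complex.sin (Real.pi * etaRoot s) / Complex.cos (2 * Real.pi * etaRoot s)))‖ ≤
      c *
      ‖rayMoment s 0 * (Complex.I * Complex.exp (-(Real.pi * Complex.I / 8)) *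
        (Complex.sin (Real.pi * etaRoot s) / Complex.cos (2 * Real.pi * etaRoot s)))‖ := by
  obtain ⟨K₀, hK₀⟩ := eventually_atTop.1 (tendsto_saddleError.eventually (ge_mem_nhds hc))
  set B := max 100 K₀ with hB
  have hB100 : 100 ≤ B := le_max_left _ _
  have hP := tendsto_norm_etaRoot.eventually_ge_atTop (B ^ 6)
  rw [eventually_inf_principal]
  filter_upwards [hP] with s hsP hs
  obtain ⟨hb, hab⟩ := etaRoot_im_pos hs
  have hB1 : 1 ≤ B ^ 6 := one_le_pow₀ (by linarith)
  have hP1 : 1 ≤ ‖etaRoot s‖ := hB1.trans hsP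
  obtain ⟨L, hL, hK₁, hK₂⟩ := exists_even_scale hP1
  have hBL : B ≤ L := by
    refine le_trans ?_ hL
    have : B = (B ^ 6) ^ (1 / 6 : ℝ) := by
      rw [← Real.rpow_natCast, ← Real.rpow_mul (by linarith)]; norm_num
    rw [this]
    exact Real.rpow_le_rpow (by positivity) hsP (by norm_num)
  have hL100 : 100 ≤ L := by exact_mod_cast hB100.trans hBL
  have hbP := one_le_etaRoot_im_mul hs hP1
  have hbK : 1 ≤ 16 * (etaRoot s).im * ((2 * L : ℕ) : ℝ) ^ (6 / 7 : ℝ) := by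
    refine hbP.trans ?_
    -- |η| ≤ (2L)⁶ converts |η|^{1/7} into (2L)^{6/7}.
    have e1 : ((2 * L : ℕ) : ℝ) ^ (6 / 7 : ℝ) = (((2 * L : ℕ) : ℝ) ^ 6) ^ (1 / 7 : ℝ) := by
      rw [← Real.rpow_natCast, ← Real.rpow_mul (by positivity)]; norm_num
    rw [e1]
    gcongr
  have hmain := norm_ray_integral_sub_le (saddle_of_etaRoot s) hb hab hL100 hK₁ hK₂ hbK
  refine ⟨?_, hmain.trans ?_⟩
  · have hσ := re_of_saddle (saddle_of_etaRoot s)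
    have hPa := norm_le_two_mul_re hb hab
    -- For `s.re < -1` the crude exponent 1/2 is enough: Re η Im η is then bounded below by 50/16,
    -- and σ = 1 - 4π Re η Im η.
    have h7 : ‖etaRoot s‖ ^ (1 / 7 : ℝ) ≤ ‖etaRoot s‖ ^ (1 / 2 : ℝ) :=
      Real.rpow_le_rpow_of_exponent_le hP1 (by norm_num)
    have h8 : ‖etaRoot s‖ = ‖etaRoot s‖ ^ (1 / 2 : ℝ) * ‖etaRoot s‖ ^ (1 / 2 : ℝ) := by
      rw [← Real.rpow_add (by linarith)]; norm_num
    have h9 : 100 ≤ ‖etaRoot s‖ ^ (1 / 2 : ℝ) := by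
      rw [show (100 : ℝ) = (10000 : ℝ) ^ (1 / 2 : ℝ) by
        rw [← Real.sqrt_eq_rpow, show (10000 : ℝ) = 100 ^ 2 by norm_num,
          Real.sqrt_sq (by norm_num)]]
      refine Real.rpow_le_rpow (by norm_num) ?_ (by norm_num)
      have : (100 : ℝ) ^ 6 ≤ B ^ 6 := by gcongr
      linarith
    have hp3 := Real.pi_gt_three
    set P := ‖etaRoot s‖ ^ (1 / 2 : ℝ)
    have hbP' : 1 ≤ 16 * (etaRoot s).im * P := hbP.trans (by gcongr)
    have hre : 100 * P ≤ 2 * (etaRoot s).re := by nlinarith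
    have h10 : 100 * P * (etaRoot s).im ≤ 2 * (etaRoot s).re * (etaRoot s).im := by gcongr
    nlinarith
  · gcongr
    apply hK₀
    have : K₀ ≤ B := le_max_right _ _
    push_cast
    linarith

/-! ### The asymptotic formulas and nonvanishing -/

theorem riemannAux_approx_eq {s : ℂ} (hs : s.re < -1) (S : ℂ) :
    Complex.exp (Real.pi * Complex.I / 4 * (s - 7 / 2)) * (Real.pi : ℂ) ^ ((s - 1) / 2) *
        Complex.sin (Real.pi * s / 2) * Complex.Gamma ((1 - s) / 2) * S =
      2 * Complex.I * diagDir * Complex.sin (Real.pi * s / 2) *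
      Complex.exp (Real.pi * Complex.I * s / 2) *
      (rayMoment s 0 * (Complex.I * Complex.exp (-(Real.pi * Complex.I / 8)) * S)) := by
  rw [rayMoment_zero (by linarith), diagDir]
  have h1 : Complex.exp (Real.pi * Complex.I / 4 * (s - 7 / 2)) =
      -(Complex.exp (Real.pi * Complex.I / 4) * Complex.exp (Real.pi * Complex.I * s / 2) *
        Complex.exp (-(Real.pi * Complex.I * s / 4)) *
        Complex.exp (-(Real.pi * Complex.I / 8))) := by
    rw [← Complex.exp_add, ← Complex.exp_add, ← Complex.exp_add, ← neg_one_mul,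
      ← Complex.exp_pi_mul_I, ← Complex.exp_add, Complex.exp_eq_exp_iff_exists_int]
    refine ⟨-1, ?_⟩
    push_cast
    ring
  rw [h1]
  set e1 := Complex.exp (Real.pi * Complex.I / 4)
  set e2 := Complex.exp (Real.pi * Complex.I * s / 2)
  set e3 := Complex.exp (-(Real.pi * Complex.I * s / 4))
  set e4 := Complex.exp (-(Real.pi * Complex.I / 8))
  linear_combination (-(e1 * e2 * e3 * e4 * (Real.pi : ℂ) ^ ((s - 1) / 2) *
        Complex.sin (Real.pi * s / 2) * Complex.Gamma ((1 - s) / 2) * S)) * Complex.I_sq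

theorem riemannAux_isEquivalent :
    riemannAux ~[cobounded ℂ ⊓ 𝓟 farLeftRegion] fun s : ℂ =>
      Complex.exp (Real.pi * Complex.I / 4 * (s - 7 / 2)) * (Real.pi : ℂ) ^ ((s - 1) / 2) *
        Complex.sin (Real.pi * s / 2) * Complex.Gamma ((1 - s) / 2) *
        (Complex.sin (Real.pi * etaRoot s) / Complex.cos (2 * Real.pi * etaRoot s)) := by
  refine isLittleO_iff.2 fun c hc => ?_
  filter_upwards [eventually_norm_ray_integral_sub_le c hc] with s hs
  obtain ⟨hs1, hle⟩ := hs
  rw [Pi.sub_apply, riemannAux_eq_ray hs1, riemannAux_approx_eq hs1, ← mul_sub, norm_mul,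
    norm_mul (_ * _ * _) (rayMoment s 0 * _), mul_left_comm c]
  exact mul_le_mul_of_nonneg_left hle (norm_nonneg _)

theorem ne_ofReal_of_im_pos {z : ℂ} (hz : 0 < z.im) (c : ℝ) : z ≠ c := by
  rintro rfl
  simp at hz

theorem sin_ne_zero_of_im_pos {z : ℂ} (hz : 0 < z.im) : Complex.sin z ≠ 0 := by
  intro h
  obtain ⟨k, hk⟩ := Complex.sin_eq_zero_iff.1 h
  exact ne_ofReal_of_im_pos hz (k * Real.pi) (by rw [hk]; push_cast; rfl)

theorem cos_ne_zero_of_im_pos {z : ℂ} (hz : 0 < z.im) : Complex.cos z ≠ 0 := by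
  intro h
  obtain ⟨k, hk⟩ := Complex.cos_eq_zero_iff.1 h
  exact ne_ofReal_of_im_pos hz ((2 * k + 1) * Real.pi / 2) (by rw [hk]; push_cast; rfl)

theorem im_pi_mul_div_two {s : ℂ} : (Real.pi * s / 2 : ℂ).im = Real.pi / 2 * s.im := by
  rw [show (Real.pi * s / 2 : ℂ) = ((Real.pi / 2 : ℝ) : ℂ) * s by push_cast; ring,
    Complex.im_ofReal_mul]

/-- Reflection at (s+1)/2 gives Γ((1+s)/2)Γ((1-s)/2) = π/cos(πs/2), which turns the sine into a
tangent; the powers of π multiply to π⁻¹. The cosine does not vanish because t > 0. -/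
theorem riemannAuxG_approx_eq {s : ℂ} (hs : 0 < s.im) (S : ℂ) :
    (Real.pi : ℂ) ^ (-((s + 1) / 2)) * Complex.exp (-(Real.pi * Complex.I * s / 4)) *
      Complex.Gamma ((s + 1) / 2) *
      (Complex.exp (Real.pi * Complex.I / 4 * (s - 7 / 2)) * (Real.pi : ℂ) ^ ((s - 1) / 2) *
        Complex.sin (Real.pi * s / 2) * Complex.Gamma ((1 - s) / 2) * S) =
      Complex.exp (-(7 * Real.pi * Complex.I / 8)) * Complex.tan (Real.pi * s / 2) * S := by
  have hp := Real.pi_pos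
  have hp0 : (Real.pi : ℂ) ≠ 0 := by exact_mod_cast Real.pi_ne_zero
  have hG : Complex.Gamma ((s + 1) / 2) * Complex.Gamma ((1 - s) / 2) =
      Real.pi / Complex.cos (Real.pi * s / 2) := by
    have := Complex.Gamma_mul_Gamma_one_sub ((s + 1) / 2)
    rw [show 1 - (s + 1) / 2 = (1 - s) / 2 by ring,
      show Real.pi * ((s + 1) / 2) = Real.pi * s / 2 + Real.pi / 2 by ring,
      Complex.sin_add_pi_div_two] at this
    exact this
  have hpow : (Real.pi : ℂ) ^ (-((s + 1) / 2)) * (Real.pi : ℂ) ^ ((s - 1) / 2) =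
      (Real.pi : ℂ)⁻¹ := by
    rw [← Complex.cpow_add _ _ hp0, ← Complex.cpow_neg_one]
    congr 1; ring
  have hexp : Complex.exp (-(Real.pi * Complex.I * s / 4)) *
      Complex.exp (Real.pi * Complex.I / 4 * (s - 7 / 2)) =
      Complex.exp (-(7 * Real.pi * Complex.I / 8)) := by
    rw [← Complex.exp_add]; congr 1; ring
  have hcos : Complex.cos (Real.pi * s / 2) ≠ 0 := by
    apply cos_ne_zero_of_im_pos
    rw [im_pi_mul_div_two]
    positivity
  calc _ = ((Real.pi : ℂ) ^ (-((s + 1) / 2)) * (Real.pi : ℂ) ^ ((s - 1) / 2)) *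
        (Complex.exp (-(Real.pi * Complex.I * s / 4)) *
          Complex.exp (Real.pi * Complex.I / 4 * (s - 7 / 2))) *
        (Complex.Gamma ((s + 1) / 2) * Complex.Gamma ((1 - s) / 2)) *
        Complex.sin (Real.pi * s / 2) * S := by ring
    _ = _ := by
        rw [hpow, hexp, hG, Complex.tan]
        field_simp

theorem riemannAuxG_isEquivalent :
    riemannAuxG ~[cobounded ℂ ⊓ 𝓟 farLeftRegion] fun s : ℂ =>
      Complex.exp (-(7 * Real.pi * Complex.I / 8)) * Complex.tan (Real.pi * s / 2) *
        (Complex.sin (Real.pi * etaRoot s) / Complex.cos (2 * Real.pi * etaRoot s)) := by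
  have h1 : (fun s : ℂ => (Real.pi : ℂ) ^ (-((s + 1) / 2)) *
      Complex.exp (-(Real.pi * Complex.I * s / 4)) * Complex.Gamma ((s + 1) / 2))
      ~[cobounded ℂ ⊓ 𝓟 farLeftRegion] _ := IsEquivalent.refl
  refine (h1.mul riemannAux_isEquivalent).congr_right ?_
  filter_upwards [mem_inf_of_right (mem_principal_self farLeftRegion)] with s hs
  exact riemannAuxG_approx_eq hs.1 _

/-- The zeros of sine and cosine and the poles of the Gamma factor occur only at real arguments,
whereas s and η have positive imaginary part. -/
theorem riemannAux_approx_ne_zero {s : ℂ} (hs : s ∈ farLeftRegion) :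
    Complex.exp (Real.pi * Complex.I / 4 * (s - 7 / 2)) * (Real.pi : ℂ) ^ ((s - 1) / 2) *
        Complex.sin (Real.pi * s / 2) * Complex.Gamma ((1 - s) / 2) *
        (Complex.sin (Real.pi * etaRoot s) / Complex.cos (2 * Real.pi * etaRoot s)) ≠ 0 := by
  have hp := Real.pi_pos
  have hp0 : (Real.pi : ℂ) ≠ 0 := by exact_mod_cast Real.pi_ne_zero
  obtain ⟨hb, -⟩ := etaRoot_im_pos hs
  have him := hs.1
  have hG : Complex.Gamma ((1 - s) / 2) ≠ 0 := by
    refine Complex.Gamma_ne_zero fun m h => ?_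
    have h2 : s = ((1 + 2 * m : ℝ) : ℂ) := by push_cast; linear_combination (-2 : ℂ) * h
    exact ne_ofReal_of_im_pos him _ h2
  refine mul_ne_zero (mul_ne_zero (mul_ne_zero (mul_ne_zero (Complex.exp_ne_zero _) ?_) ?_) hG)
    (div_ne_zero ?_ ?_)
  · simp [Complex.cpow_eq_zero_iff, hp0]
  · apply sin_ne_zero_of_im_pos
    rw [im_pi_mul_div_two]
    positivity
  · apply sin_ne_zero_of_im_pos
    rw [Complex.im_ofReal_mul]
    positivity
  · apply cos_ne_zero_of_im_pos
    rw [show (2 * Real.pi * etaRoot s : ℂ) = ((2 * Real.pi : ℝ) : ℂ) * etaRoot s by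
      push_cast; ring, Complex.im_ofReal_mul]
    positivity

theorem exists_radius_riemannAux_ne_zero :
    ∃ R : ℝ, ∀ s ∈ farLeftRegion, R < ‖s‖ → riemannAux s ≠ 0 := by
  -- With relative error 1/2, a zero of 𝔣 would force the nonzero approximant to be at most half of
  -- itself in modulus.
  have h := isLittleO_iff.1 riemannAux_isEquivalent (show (0 : ℝ) < 1 / 2 by norm_num)
  rw [eventually_inf_principal, ← comap_norm_atTop, eventually_comap] at h
  obtain ⟨R, hR⟩ := eventually_atTop.1 h
  refine ⟨R, fun s hs hsR h0 => ?_⟩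
  have h1 := hR ‖s‖ hsR.le s rfl hs
  rw [Pi.sub_apply, h0, zero_sub, norm_neg] at h1
  have h2 := norm_pos_iff.2 (riemannAux_approx_ne_zero hs)
  linarith

theorem mainTheorem7 :
    (riemannAux ~[cobounded ℂ ⊓ 𝓟 farLeftRegion] fun s : ℂ =>
      Complex.exp (Real.pi * Complex.I / 4 * (s - 7 / 2)) * (Real.pi : ℂ) ^ ((s - 1) / 2) *
        Complex.sin (Real.pi * s / 2) * Complex.Gamma ((1 - s) / 2) *
        (Complex.sin (Real.pi * etaRoot s) / Complex.cos (2 * Real.pi * etaRoot s))) ∧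
    (riemannAuxG ~[cobounded ℂ ⊓ 𝓟 farLeftRegion] fun s : ℂ =>
      Complex.exp (-(7 * Real.pi * Complex.I / 8)) * Complex.tan (Real.pi * s / 2) *
        (Complex.sin (Real.pi * etaRoot s) / Complex.cos (2 * Real.pi * etaRoot s))) ∧
    ∃ R : ℝ, ∀ s ∈ farLeftRegion, R < ‖s‖ → riemannAux s ≠ 0 :=
  ⟨riemannAux_isEquivalent, riemannAuxG_isEquivalent, exists_radius_riemannAux_ne_zero⟩
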